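/- Let $k \ge 1$ be an integer and let $p, q \in \mathbb{C}$. Let $B_k$ be the group of permutations $w$ of $\{\pm 1, \ldots, \pm k\}$ with $w(-i) = -w(i)$ for all $i$, viewed as a Coxeter group with simple reflections $t = (-1, 1)$ and $s_i = (-i, -(i+1))(i, i+1)$ for $1 \le i \le k-1$, and let $\ell$ be the corresponding length function. The Coxeter matrix is given by $m_{t, s_1} = 4$, $m_{s_i, s_{i+1}} = 3$, and $m = 2$ for all other pairs of distinct simple reflections. Let $H_{p,q}(B_k)$ be the $\mathbb{C}$-algebra with generators $T_s$, one for each simple reflection $s$, and relations the braid relations $T_sT_{s'}T_s\cdots = T_{s'}T_sT_{s'}\cdots$ ($m_{s,s'}$ factors on each side, $s \ne s'$) together with $(T_t - 1)(T_t + p) = 0$ and $(T_{s_i} - 1)(T_{s_i} + q) = 0$ for $1 \le i \le k-1$. For $w \in B_k$ let $T_w = T_{r_1} \cdots T_{r_l}$, where $w = r_1 \cdots r_l$ is a reduced expression in simple reflections. Let $S_k \subset B_k$ be the subgroup generated by $s_1, \ldots, s_{k-1}$, let $X_{0,k}$ be the set of elements $x \in B_k$ of minimal length in their right coset $S_k x$,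 and let $w_{0,k}$ be the element of maximal length in $X_{0,k}$. Let $G_k$ be the set of $w \in B_k$ such that $w^2 = 1$ and, for each $1 \le i \le k$, either $w(i) = i$ or $w(i) < 0$. For $w \in B_k$ let $-w \in B_k$ be given by $(-w)(i) = -w(i)$, let $a(w)$ be the number of $i \in \{1, \ldots, k\}$ with $w(i) = i$, and let $c(w)$ be the number of unordered pairs $\{i, j\}$ of distinct elements of $\{1, \ldots, k\}$ such that $-w(i) < j$ and $-w(j) < i$. Then, in $H_{p,q}(B_k)$, \[ T_{w_{0,k}}^2 = \sum_{w \in G_k} p^{\frac{k + a(w) - a(-w)}{2}} (1-p)^{a(-w)} q^{c(w)} (1-q)^{\frac{k - a(w) - a(-w)}{2}}\, T_w . \] (For $w \in G_k$ all exponents are nonnegative integers, and $0^0 = 1$.) -/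

import Mathlib

noncomputable section

namespace TypeB

/-- The set `{±1, …, ±k}`. -/
abbrev SignedSet (k : ℕ) : Type := {x : ℤ // x ∈ (Finset.Icc (-(k : ℤ)) k).erase 0}

theorem mem_signed {k : ℕ} {x : ℤ} :
    x ∈ (Finset.Icc (-(k : ℤ)) k).erase 0 ↔ x ≠ 0 ∧ -(k : ℤ) ≤ x ∧ x ≤ k := by
  simp

/-- The point `-x`. -/
def negPt {k : ℕ} (x : SignedSet k) : SignedSet k :=
  ⟨-x.1, by have := mem_signed.1 x.2; rw [mem_signed]; omega⟩

@[simp] theorem negPt_val {k : ℕ} (x : SignedSet k) : (negPt x).1 = -x.1 := rfl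

@[simp] theorem negPt_negPt {k : ℕ} (x : SignedSet k) : negPt (negPt x) = x :=
  Subtype.ext (by simp)

/-- The group `B_k` of permutations `w` of `{±1, …, ±k}` with `w(-x) = -w(x)`. -/
def B (k : ℕ) : Subgroup (Equiv.Perm (SignedSet k)) where
  carrier := {w | ∀ x, w (negPt x) = negPt (w x)}
  mul_mem' := by
    intro v w hv hw x
    simp only [Set.mem_ofPred_eq] at hv hw
    simp [hv, hw]
  one_mem' := fun _ => rfl
  inv_mem' := by
    intro w hw x
    simp only [Set.mem_ofPred_eq] at hw
    rw [Equiv.Perm.inv_eq_iff_eq, hw]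
    simp

/-- The element `-w`, given by `(-w)(x) = -w(x)`. -/
def neg {k : ℕ} (w : B k) : B k :=
  ⟨w.1.trans ⟨negPt, negPt, negPt_negPt, negPt_negPt⟩, fun x => by simp [w.2 x]⟩

theorem swap_val {k : ℕ} (u v x : SignedSet k) : (Equiv.swap u v x).1 =
    if x.1 = u.1 then v.1 else if x.1 = v.1 then u.1 else x.1 := by
  simp only [Equiv.swap_apply_def, Subtype.ext_iff, apply_ite Subtype.val]

/-- The simple reflections: index `0` gives `t = (-1, 1)`, and an index `i ≥ 1` gives
`s_i = (-i, -(i+1)) (i, i+1)`. -/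
def simple {k : ℕ} (i : Fin k) : B k :=
  if h : (i : ℕ) = 0 then
    ⟨Equiv.swap ⟨-1, mem_signed.2 (by omega)⟩ ⟨1, mem_signed.2 (by omega)⟩, by
      intro x
      apply Subtype.ext
      simp only [swap_val, negPt_val]
      split_ifs <;> omega⟩
  else
    ⟨Equiv.swap ⟨-(i : ℤ), mem_signed.2 (by omega)⟩ ⟨-((i : ℤ) + 1), mem_signed.2 (by omega)⟩ *
      Equiv.swap ⟨(i : ℤ), mem_signed.2 (by omega)⟩ ⟨(i : ℤ) + 1, mem_signed.2 (by omega)⟩, by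
      intro x
      apply Subtype.ext
      simp only [Equiv.Perm.mul_apply, swap_val, negPt_val]
      split_ifs <;> omega⟩

/-- The product in `B_k` of a word in the simple reflections. -/
def wordProd {k : ℕ} (l : List (Fin k)) : B k := (l.map simple).prod

theorem simple_val {k : ℕ} (i : Fin k) (x : SignedSet k) :
    ((simple i).1 x).1 =
      if (i : ℕ) = 0 then (if x.1 = 1 then -1 else if x.1 = -1 then 1 else x.1)
      else if x.1 = i then (i : ℤ) + 1 else if x.1 = (i : ℤ) + 1 then (i : ℤ)
      else if x.1 = -(i : ℤ) then -((i : ℤ) + 1) else if x.1 = -((i : ℤ) + 1) then -(i : ℤ)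
      else x.1 := by
  unfold simple
  by_cases h : (i : ℕ) = 0
  · simp only [h, dite_true, if_true, swap_val]
    split_ifs <;> omega
  · simp only [h, dite_false, if_false, Equiv.Perm.mul_apply, swap_val]
    split_ifs <;> omega

theorem simple_mul_self {k : ℕ} (i : Fin k) : simple i * simple i = 1 := by
  apply Subtype.ext
  ext x
  have h1 := simple_val i x
  have h2 := simple_val i ((simple i).1 x)
  have hx := mem_signed.1 x.2
  change ((simple i).1 ((simple i).1 x)).1 = x.1
  rw [h2]
  split_ifs at h1 ⊢ <;> omega

/-- A simple reflection moves any `x < m` with `|x| ≤ m` one step up, fixing all points above `m`. -/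
theorem exists_step {k m : ℕ} (hm : m ≤ k) (x : SignedSet k) (h1 : -(m : ℤ) ≤ x.1)
    (h2 : x.1 < m) : ∃ i : Fin k, x.1 < ((simple i).1 x).1 ∧ ((simple i).1 x).1 ≤ m ∧
      ∀ y : SignedSet k, (m : ℤ) < y.1 → (simple i).1 y = y := by
  have hx := mem_signed.1 x.2
  obtain ⟨j, hj⟩ : ∃ j : ℕ, (x.1 < 0 ∧ (j : ℤ) + 1 = -x.1) ∨ (0 < x.1 ∧ (j : ℤ) = x.1) := by
    rcases lt_or_gt_of_ne hx.1 with h | h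
    · exact ⟨(-x.1 - 1).toNat, by omega⟩
    · exact ⟨x.1.toNat, by omega⟩
  refine ⟨⟨j, by omega⟩, ?_, ?_, ?_⟩
  · rw [simple_val]; simp only; split_ifs <;> omega
  · rw [simple_val]; simp only; split_ifs <;> omega
  · intro y hy
    apply Subtype.ext
    rw [simple_val]; simp only; split_ifs <;> omega

theorem exists_word_to_top {k m : ℕ} (hm : m ≤ k) (n : ℕ) : ∀ x : SignedSet k,
    -(m : ℤ) ≤ x.1 → x.1 ≤ m → (m : ℤ) - x.1 ≤ n →
    ∃ l : List (Fin k), ((wordProd l).1 x).1 = m ∧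
      ∀ y : SignedSet k, (m : ℤ) < y.1 → (wordProd l).1 y = y := by
  induction n with
  | zero =>
    intro x _ h2 h3
    exact ⟨[], by simp only [wordProd, List.map_nil, List.prod_nil]; change x.1 = m; omega,
      fun _ _ => rfl⟩
  | succ n ih =>
    intro x h1 h2 h3
    rcases eq_or_lt_of_le h2 with h | h
    · exact ih x h1 h2 (by omega)
    · obtain ⟨i, hi1, hi2, hi3⟩ := exists_step hm x h1 h
      obtain ⟨l, hl1, hl2⟩ := ih ((simple i).1 x) (by omega) hi2 (by omega)
      refine ⟨l ++ [i], ?_, ?_⟩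
      · simpa [wordProd] using hl1
      · intro y hy
        have := hl2 y hy
        simp only [wordProd, List.map_append, List.prod_append, List.map_cons, List.map_nil,
          List.prod_singleton, Subgroup.coe_mul, Equiv.Perm.mul_apply, hi3 y hy] at this ⊢
        exact this

theorem wordProd_reverse {k : ℕ} (l : List (Fin k)) : wordProd l.reverse * wordProd l = 1 := by
  induction l with
  | nil => simp [wordProd]
  | cons i l ih =>
    have : wordProd (i :: l).reverse * wordProd (i :: l) =
        wordProd l.reverse * (simple i * simple i) * wordProd l := by
      simp [wordProd, mul_assoc]
    rw [this, simple_mul_self, mul_one, ih]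

theorem exists_word_of_fix {k : ℕ} (m : ℕ) : m ≤ k → ∀ w : B k,
    (∀ y : SignedSet k, (m : ℤ) < y.1 → w.1 y = y) → ∃ l, wordProd l = w := by
  induction m with
  | zero =>
    intro _ w hw
    refine ⟨[], ?_⟩
    apply Subtype.ext
    ext x
    have hx := mem_signed.1 x.2
    change x.1 = (w.1 x).1
    rcases lt_or_gt_of_ne hx.1 with h | h
    · have h1 := hw (negPt x) (by simp; omega)
      rw [w.2 x] at h1
      have := congrArg Subtype.val h1
      simp only [negPt_val] at this
      omega
    · rw [hw x (by simpa using h)]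
  | succ m ih =>
    intro hm w hw
    let x : SignedSet k := ⟨(m : ℤ) + 1, by rw [mem_signed]; omega⟩
    have hup : ¬ ((m : ℤ) + 1 < (w.1 x).1) := by
      intro h
      have := congrArg Subtype.val (w.1.injective (hw (w.1 x) (by push_cast; omega)))
      change (w.1 x).1 = (m : ℤ) + 1 at this
      omega
    have hlo : ¬ ((w.1 x).1 < -((m : ℤ) + 1)) := by
      intro h
      have h1 := hw (negPt (w.1 x)) (by push_cast; simp only [negPt_val]; omega)
      rw [← w.2 x] at h1
      have := congrArg Subtype.val (w.1.injective h1)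
      rw [w.2 x] at this
      simp only [negPt_val] at this
      change -(w.1 x).1 = -((m : ℤ) + 1) at this
      omega
    obtain ⟨l, hl1, hl2⟩ := exists_word_to_top hm (2 * (m + 1)) (w.1 x)
      (by push_cast; omega) (by push_cast; omega) (by push_cast; omega)
    obtain ⟨l', hl'⟩ := ih (by omega) (wordProd l * w) (by
      intro y hy
      change (wordProd l).1 (w.1 y) = y
      rcases eq_or_lt_of_le (show (m : ℤ) + 1 ≤ y.1 by omega) with h | h
      · have hy' : y = x := Subtype.ext h.symm
        rw [hy']
        apply Subtype.ext
        rw [hl1]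
        push_cast
        rfl
      · rw [hw y (by push_cast; omega), hl2 y (by push_cast; omega)])
    refine ⟨l.reverse ++ l', ?_⟩
    have : wordProd (l.reverse ++ l') = wordProd l.reverse * wordProd l' := by simp [wordProd]
    rw [this, hl', ← mul_assoc, wordProd_reverse, one_mul]

/-- The simple reflections generate `B_k`. -/
theorem exists_word {k : ℕ} (w : B k) : ∃ l, wordProd l = w :=
  exists_word_of_fix k le_rfl w (fun y hy => by have := mem_signed.1 y.2; omega)

/-- The length of `w` with respect to the simple reflections. -/
def length {k : ℕ} (w : B k) : ℕ := sInf {n | ∃ l : List (Fin k), l.length = n ∧ wordProd l = w}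

/-- The word `l` is a reduced expression of `w`. -/
def IsReducedExpr {k : ℕ} (l : List (Fin k)) (w : B k) : Prop :=
  wordProd l = w ∧ l.length = length w

theorem exists_isReducedExpr {k : ℕ} (w : B k) : ∃ l, IsReducedExpr l w := by
  obtain ⟨l, hl⟩ := exists_word w
  obtain ⟨l', h1, h2⟩ :=
    Nat.sInf_mem (s := {n | ∃ l : List (Fin k), l.length = n ∧ wordProd l = w}) ⟨_, l, rfl, hl⟩
  exact ⟨l', h2, h1⟩

/-- The Coxeter matrix of `B_k`: `m(t, s_1) = 4`, `m(s_i, s_{i+1}) = 3`, and `2` for the other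
pairs of distinct simple reflections. -/
def coxeterMatrix (k : ℕ) : CoxeterMatrix (Fin k) where
  M := Matrix.of fun i j : Fin k =>
    if i = j then 1
    else if ((i : ℕ) = 0 ∧ (j : ℕ) = 1) ∨ ((i : ℕ) = 1 ∧ (j : ℕ) = 0) then 4
    else if (i : ℕ) + 1 = j ∨ (j : ℕ) + 1 = i then 3
    else 2
  isSymm := by unfold Matrix.IsSymm; aesop
  diagonal := by simp
  off_diagonal := by aesop

/-- The defining relations of the Hecke algebra with parameters `r`: the braid relations and
`(T_s - 1) (T_s + r(s)) = 0`. -/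
inductive HeckeRel {ι : Type} (M : CoxeterMatrix ι) (r : ι → ℂ) :
    FreeAlgebra ℂ ι → FreeAlgebra ℂ ι → Prop
  | braid (i j : ι) (h : i ≠ j) : HeckeRel M r
      ((CoxeterSystem.alternatingWord i j (M i j)).map (FreeAlgebra.ι ℂ)).prod
      ((CoxeterSystem.alternatingWord j i (M i j)).map (FreeAlgebra.ι ℂ)).prod
  | quadratic (i : ι) : HeckeRel M r
      ((FreeAlgebra.ι ℂ i - 1) * (FreeAlgebra.ι ℂ i + algebraMap ℂ (FreeAlgebra ℂ ι) (r i))) 0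

/-- The Hecke algebra `H_{p,q}(B_k)`, with parameter `p` at `t` and `q` at every `s_i`. -/
abbrev Hecke (k : ℕ) (p q : ℂ) : Type :=
  RingQuot (HeckeRel (coxeterMatrix k) (fun i : Fin k => if (i : ℕ) = 0 then p else q))

/-- The generator `T_s` attached to a simple reflection. -/
def heckeGen {k : ℕ} (p q : ℂ) (i : Fin k) : Hecke k p q :=
  RingQuot.mkAlgHom ℂ _ (FreeAlgebra.ι ℂ i)

/-- The element `T_w = T_{s_1} ⋯ T_{s_l}`, for a reduced expression `w = s_1 ⋯ s_l`. -/
def T {k : ℕ} (p q : ℂ) (w : B k) : Hecke k p q :=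
  ((exists_isReducedExpr w).choose.map (heckeGen p q)).prod

/-- The parabolic subgroup `S_k` of `B_k`, generated by the `s_i` with `i ≥ 1`. -/
def symmetricSubgroup (k : ℕ) : Subgroup (B k) :=
  Subgroup.closure {w | ∃ i : Fin k, (i : ℕ) ≠ 0 ∧ w = simple i}

/-- The set `X_{0,k}` of elements `x` that have minimal length in their right coset `S_k x`. -/
def distinguishedReps (k : ℕ) : Set (B k) :=
  {x | ∀ u ∈ symmetricSubgroup k, length x ≤ length (u * x)}

theorem exists_longest_rep (k : ℕ) :
    ∃ w ∈ distinguishedReps k, ∀ x ∈ distinguishedReps k, length x ≤ length w := by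
  refine Set.exists_max_image _ length (Set.toFinite _) ⟨1, fun u _ => ?_⟩
  have : length (1 : B k) ≤ 0 := Nat.sInf_le ⟨[], rfl, rfl⟩
  omega

/-- The element `w_{0,k}` of maximal length in `X_{0,k}`. -/
def w0 (k : ℕ) : B k := (exists_longest_rep k).choose

/-- The element `w` is good: `w² = 1` and each `i ∈ {1, …, k}` has `w(i) = i` or `w(i) < 0`. -/
def IsGood {k : ℕ} (w : B k) : Prop :=
  w ^ 2 = 1 ∧ ∀ i : SignedSet k, 0 < i.1 → w.1 i = i ∨ (w.1 i).1 < 0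

open Classical in
/-- The set `G_k` of good involutions. -/
def good (k : ℕ) : Finset (B k) := Finset.univ.filter IsGood

/-- The number `a(w)` of `i ∈ {1, …, k}` with `w(i) = i`. -/
def a {k : ℕ} (w : B k) : ℕ :=
  (Finset.univ.filter fun i : SignedSet k => 0 < i.1 ∧ w.1 i = i).card

/-- The number `c(w)` of tidy pairs: unordered pairs `{i, j}`, listed here with `0 < i < j ≤ k`,
such that `-w(i) < j` and `-w(j) < i`. -/
def c {k : ℕ} (w : B k) : ℕ :=
  (Finset.univ.filter fun x : SignedSet k × SignedSet k =>
    0 < x.1.1 ∧ x.1.1 < x.2.1 ∧ -(w.1 x.1).1 < x.2.1 ∧ -(w.1 x.2).1 < x.1.1).card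

end TypeB

end

set_option linter.unusedSimpArgs false
set_option linter.unusedSectionVars false

noncomputable section

namespace TypeB

/-! The proof is an induction on `n ≤ k` for `longRep k n`, the element `w_{0,n}` inside `B_k`.
Since `w_{0,n+1} = t s_1 ⋯ s_n w_{0,n}` with lengths adding, and both longest representatives are
involutions, `T_{w_{0,n+1}}²` arises from `T_{w_{0,n}}²` by multiplying successively on both sides
by `T_{s_n}, …, T_{s_1}, T_t` (`prodAlong_longRep_succ_sq`).

Apply this to a basis element `T_w` with `w` good and fixing all points above `n`. The conjugates
`u` of `w` that occur fix `i + 1` when the turn of `s_i` comes. If `u` also fixes `i`, then `s_i`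
commutes with `u`, and the quadratic relation splits the term as `q T_u + (1 - q) T_{u s_i}`
(`conj_prodAlong_of_fix`). Otherwise `u(i) < 0`, the length rises on both sides, and the result is
the single term `T_{s_i u s_i}` (`conj_prodAlong_of_asc`). A term that has split off through `u s_i`
never splits again. The last factor `t` splits the remaining main term with `p` in place of `q`.
Hence `w` yields one term for each possible value at `1` of a good involution on `n + 1` points:
`1`, `-1`, or `-(m + 1)` with `m` a fixed point of `w` (`conj_cyc_prodAlong`,
`conj_cyc_prodAlong_zero`). Every good involution on `n + 1` points arises exactly once
(`restrict_extend`, `extend_restrict`, `isGoodAt_restrict`).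

The coefficients agree because the claimed weight is a product over points and pairs, which grows by
the same factor when a point is added (`pointWeight_extend`, `pairWeight_extend`).

Two foundations are needed. Since `T_w` is built from a chosen reduced word, multiplicativity along
ascents is Matsumoto's theorem, proved here through inversion counts (`length_eq_invCount`,
`prodAlong_mul_simple`). The abstractly chosen `w0 k` must also be identified with `longRep k k`
(`w0_eq_longRep`). -/

/-! ### Signed permutations as odd permutations of the integers. -/

/-- The action of a signed permutation on all integers, trivial outside `{±1, …, ±k}`. -/
def act {k : ℕ} : B k →* Equiv.Perm ℤ := Equiv.Perm.ofSubtype.comp (B k).subtype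

theorem act_coe {k : ℕ} (w : B k) (x : SignedSet k) : act w x.1 = (w.1 x).1 :=
  Equiv.Perm.ofSubtype_apply_coe _ _

theorem act_of_notMem {k : ℕ} (w : B k) {x : ℤ}
    (h : x ∉ (Finset.Icc (-(k : ℤ)) k).erase 0) : act w x = x :=
  Equiv.Perm.ofSubtype_apply_of_not_mem _ h

theorem act_mul {k : ℕ} (v w : B k) (x : ℤ) : act (v * w) x = act v (act w x) := by
  rw [map_mul]; rfl

theorem act_one {k : ℕ} (x : ℤ) : act (1 : B k) x = x := by rw [map_one]; rfl

theorem act_inv_act {k : ℕ} (w : B k) (x : ℤ) : act w⁻¹ (act w x) = x := by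
  rw [← act_mul, inv_mul_cancel, act_one]

theorem act_act_inv {k : ℕ} (w : B k) (x : ℤ) : act w (act w⁻¹ x) = x := by
  rw [← act_mul, mul_inv_cancel, act_one]

theorem act_inj {k : ℕ} (w : B k) {x y : ℤ} : act w x = act w y ↔ x = y :=
  (act w).injective.eq_iff

@[simp] theorem act_zero {k : ℕ} (w : B k) : act w 0 = 0 :=
  act_of_notMem w (by simp)

theorem act_of_lt {k : ℕ} (w : B k) {x : ℤ} (h : (k : ℤ) < x) : act w x = x :=
  act_of_notMem w (by rw [mem_signed]; omega)

theorem act_neg {k : ℕ} (w : B k) (x : ℤ) : act w (-x) = -act w x := by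
  by_cases h : x ∈ (Finset.Icc (-(k : ℤ)) k).erase 0
  · have := congrArg Subtype.val (w.2 ⟨x, h⟩)
    rw [negPt_val, ← act_coe, ← act_coe] at this
    exact this
  · have h' : -x ∉ (Finset.Icc (-(k : ℤ)) k).erase 0 := by rw [mem_signed] at h ⊢; omega
    rw [act_of_notMem w h, act_of_notMem w h']

theorem act_ne_zero {k : ℕ} (w : B k) {x : ℤ} (h : x ≠ 0) : act w x ≠ 0 := by
  rw [← act_zero w, Ne, act_inj]; exact h

theorem act_le {k : ℕ} (w : B k) {x : ℤ} (h : x ≤ k) : act w x ≤ k := by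
  by_contra! h'
  have := act_of_lt w h'
  rw [act_inj] at this
  omega

theorem le_act {k : ℕ} (w : B k) {x : ℤ} (h : -(k : ℤ) ≤ x) : -(k : ℤ) ≤ act w x := by
  have := act_le w (x := -x) (by omega)
  rw [act_neg] at this
  omega

theorem ext_act {k : ℕ} {v w : B k} (h : ∀ x : ℤ, 0 < x → act v x = act w x) : v = w := by
  apply Subtype.ext
  ext x
  rw [← act_coe, ← act_coe]
  rcases lt_trichotomy x.1 0 with hx | hx | hx
  · have := h (-x.1) (by omega)
    rw [act_neg, act_neg] at this
    omega
  · rw [hx, act_zero, act_zero]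
  · exact h _ hx

/-- The signed permutation with a given odd extension to the integers. -/
def ofPerm {k : ℕ} (e : Equiv.Perm ℤ) (hodd : ∀ x, e (-x) = -e x)
    (hfix : ∀ x, (k : ℤ) < x → e x = x) : B k :=
  ⟨e.subtypePerm (p := fun x => x ∈ (Finset.Icc (-(k : ℤ)) k).erase 0) (by
    intro x
    have h0 : e 0 = 0 := by have := hodd 0; simp at this; omega
    have h1 : (k : ℤ) < x → e x = x := hfix x
    have h2 : (k : ℤ) < e x → e x = x := fun h => e.injective (hfix _ h)
    have h3 : (k : ℤ) < -x → e x = x := fun h => by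
      have := hfix _ h
      rw [hodd] at this
      omega
    have h4 : (k : ℤ) < -e x → e x = x := fun h => by
      have := hfix _ h
      rw [← hodd] at this
      have := e.injective this
      rw [hodd] at this
      omega
    have h5 : e x = 0 ↔ x = 0 := by rw [← e.injective.eq_iff (a := x), h0]
    rw [mem_signed, mem_signed]
    omega), fun x => Subtype.ext (hodd x.1)⟩

theorem act_ofPerm {k : ℕ} (e : Equiv.Perm ℤ) (hodd : ∀ x, e (-x) = -e x)
    (hfix : ∀ x, (k : ℤ) < x → e x = x) (x : ℤ) : act (ofPerm e hodd hfix) x = e x := by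
  change Equiv.Perm.ofSubtype (ofPerm e hodd hfix).1 x = e x
  unfold ofPerm
  rw [Equiv.Perm.ofSubtype_subtypePerm]
  intro y hy
  have h0 : e 0 = 0 := by have := hodd 0; simp at this; omega
  have h1 := hfix y
  have h2 := hfix (-y)
  rw [hodd] at h2
  rw [mem_signed]
  by_contra hc
  rcases eq_or_ne y 0 with rfl | hy0
  · exact hy h0
  · omega

theorem act_simple {k : ℕ} (i : Fin k) (x : ℤ) : act (simple i) x =
    if (i : ℕ) = 0 then (if x = 1 then -1 else if x = -1 then 1 else x)
      else if x = i then (i : ℤ) + 1 else if x = (i : ℤ) + 1 then (i : ℤ)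
      else if x = -(i : ℤ) then -((i : ℤ) + 1) else if x = -((i : ℤ) + 1) then -(i : ℤ)
      else x := by
  by_cases h : x ∈ (Finset.Icc (-(k : ℤ)) k).erase 0
  · rw [act_coe (simple i) ⟨x, h⟩, simple_val]
  · rw [act_of_notMem _ h]
    rw [mem_signed] at h
    split_ifs <;> omega

theorem simple_inv {k : ℕ} (i : Fin k) : (simple i)⁻¹ = simple i :=
  inv_eq_of_mul_eq_one_left (simple_mul_self i)

/-! ### Length as an inversion number. -/

/-- The number of inversions of a signed permutation, counted over pairs `-y < x < y`. -/
def invCount {k : ℕ} (w : B k) : ℕ :=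
  ((Finset.Icc (-(k : ℤ)) k ×ˢ Finset.Icc (1 : ℤ) k).filter fun z =>
    -z.2 < z.1 ∧ z.1 < z.2 ∧ act w z.2 < act w z.1).card

/-- The new inversion is `(i, i + 1)`; the others are carried over by applying `s_i` to both
entries. Because `w(0) = 0`, the index `0` needs no separate convention: an ascent there means `w(1)
> 0`, and pairs `(0, y)` record the sign changes. -/
theorem invCount_mul_simple {k : ℕ} (w : B k) (i : Fin k) (h : act w i < act w ((i : ℤ) + 1)) :
    invCount (w * simple i) = invCount w + 1 := by
  unfold invCount
  set S := (Finset.Icc (-(k : ℤ)) k ×ˢ Finset.Icc (1 : ℤ) k).filter fun z =>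
    -z.2 < z.1 ∧ z.1 < z.2 ∧ act w z.2 < act w z.1 with hS
  set S' := (Finset.Icc (-(k : ℤ)) k ×ˢ Finset.Icc (1 : ℤ) k).filter fun z =>
    -z.2 < z.1 ∧ z.1 < z.2 ∧ act (w * simple i) z.2 < act (w * simple i) z.1 with hS'
  have hik := i.2
  have hmem : ((i : ℤ), (i : ℤ) + 1) ∈ S' := by
    simp only [hS', Finset.mem_filter, Finset.mem_product, Finset.mem_Icc, act_mul]
    refine ⟨by omega, by omega, by omega, ?_⟩
    have e1 : act (simple i) (i : ℤ) = if (i : ℕ) = 0 then (0 : ℤ) else (i : ℤ) + 1 := by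
      rw [act_simple]
      by_cases h0 : (i : ℕ) = 0 <;> simp [h0]
    have e2 : act (simple i) ((i : ℤ) + 1) = if (i : ℕ) = 0 then (-1 : ℤ) else (i : ℤ) := by
      rw [act_simple]; split_ifs <;> omega
    rw [e1, e2]
    split_ifs with h0
    · simp only [h0, Nat.cast_zero, zero_add, act_zero] at h
      rw [act_neg, act_zero]; omega
    · exact h
  have hnot : ((i : ℤ), (i : ℤ) + 1) ∉ S := by
    simp only [hS, Finset.mem_filter, Finset.mem_product, Finset.mem_Icc]
    omega
  rw [← Finset.card_erase_add_one hmem]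
  congr 1
  let f : ℤ × ℤ → ℤ × ℤ := fun z =>
    if 0 < act (simple i) z.1 + act (simple i) z.2 then (act (simple i) z.1, act (simple i) z.2)
    else (-act (simple i) z.2, -act (simple i) z.1)
  have hfe : ∀ x y, f (x, y) = if 0 < act (simple i) x + act (simple i) y
      then (act (simple i) x, act (simple i) y)
      else (-act (simple i) y, -act (simple i) x) := fun _ _ => rfl
  clear_value f
  have hss : ∀ x, act (simple i) (act (simple i) x) = x := fun x => by
    rw [← act_mul, simple_mul_self, act_one]
  have hsb1 : ∀ x : ℤ, x ≤ k → act (simple i) x ≤ k := fun x hx => act_le _ hx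
  have hsb2 : ∀ x : ℤ, -(k : ℤ) ≤ x → -(k : ℤ) ≤ act (simple i) x := fun x hx => le_act _ hx
  -- The only pair that leaves the region `x + y > 0` is `(-i, i + 1)`, sent to `(-(i + 1), i)`;
  -- negating and exchanging the entries, as `f` does, returns the original pair.
  have key : ∀ x y : ℤ, -y < x → x < y → (x, y) ≠ ((i : ℤ), (i : ℤ) + 1) →
      act (simple i) x < act (simple i) y ∧
      (0 < act (simple i) x + act (simple i) y ∨
        (x = -(i : ℤ) ∧ y = (i : ℤ) + 1 ∧ (i : ℕ) ≠ 0)) := by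
    intro x y h1 h2 h3
    rw [Ne, Prod.mk.injEq] at h3
    rw [act_simple, act_simple]
    split_ifs <;> omega
  have spec : (i : ℕ) ≠ 0 → act (simple i) (-(i : ℤ)) = -((i : ℤ) + 1) ∧
      act (simple i) ((i : ℤ) + 1) = i := by
    intro h0
    rw [act_simple, act_simple]
    constructor <;> split_ifs <;> omega
  have ne_image : ∀ x y : ℤ, -y < x → x < y → (x, y) ≠ ((i : ℤ), (i : ℤ) + 1) →
      ¬ (act (simple i) x = i ∧ act (simple i) y = (i : ℤ) + 1) := by
    intro x y h1 h2 h3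
    rw [Ne, Prod.mk.injEq] at h3
    rw [act_simple, act_simple]
    split_ifs <;> omega
  have hf : ∀ x y : ℤ, -y < x → x < y → (x, y) ≠ ((i : ℤ), (i : ℤ) + 1) →
      f (f (x, y)) = (x, y) := by
    intro x y h1 h2 h3
    obtain ⟨-, h4 | ⟨rfl, rfl, h0⟩⟩ := key x y h1 h2 h3
    · rw [hfe x y, if_pos h4, hfe, hss, hss, if_pos (by omega)]
    · obtain ⟨e1, e2⟩ := spec h0
      rw [hfe (-(i : ℤ)), e1, e2, if_neg (by omega), neg_neg, hfe,
        e1, e2, if_neg (by omega), neg_neg]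
  refine Finset.card_nbij' f f ?_ ?_ ?_ ?_
  · rintro ⟨x, y⟩ hz
    simp only [Finset.coe_erase, hS', Set.mem_sdiff, Finset.coe_filter,
      Set.mem_ofPred_eq, Finset.mem_product, Finset.mem_Icc, Set.mem_singleton_iff, act_mul] at hz
    obtain ⟨⟨⟨⟨b1, b2⟩, b3, b4⟩, h1, h2, h3⟩, h4⟩ := hz
    obtain ⟨h5, h6 | ⟨rfl, rfl, h0⟩⟩ := key x y h1 h2 h4
    · simp only [hfe, h6, if_true, hS, Finset.coe_filter, Set.mem_ofPred_eq,
      Finset.mem_product, Finset.mem_Icc]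
      have := hsb1 x; have := hsb1 y; have := hsb2 x; have := hsb2 y
      exact ⟨⟨⟨by omega, by omega⟩, by omega, by omega⟩, by omega, h5, h3⟩
    · obtain ⟨e1, e2⟩ := spec h0
      simp only [hfe, e1, e2, hS, Finset.coe_filter, Set.mem_ofPred_eq]
      rw [e1, e2, act_neg] at h3
      rw [if_neg (by omega)]
      simp only [Finset.mem_product, Finset.mem_Icc, neg_neg, act_neg]
      exact ⟨⟨⟨by omega, by omega⟩, by omega, by omega⟩, by omega, by omega, by omega⟩
  · rintro ⟨x, y⟩ hz
    have h4 : (x, y) ≠ ((i : ℤ), (i : ℤ) + 1) := by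
      rintro hc
      rw [hc] at hz
      exact hnot hz
    simp only [hS, Finset.coe_filter, Set.mem_ofPred_eq,
      Finset.mem_product, Finset.mem_Icc] at hz
    obtain ⟨⟨⟨b1, b2⟩, b3, b4⟩, h1, h2, h3⟩ := hz
    obtain ⟨h5, h6 | ⟨rfl, rfl, h0⟩⟩ := key x y h1 h2 h4
    · simp only [hfe, h6, if_true, hS', Finset.coe_erase, Set.mem_sdiff, Finset.coe_filter,
      Set.mem_ofPred_eq, Finset.mem_product, Finset.mem_Icc, Set.mem_singleton_iff, act_mul,
        hss, Prod.mk.injEq]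
      have := hsb1 x; have := hsb1 y; have := hsb2 x; have := hsb2 y
      exact ⟨⟨⟨⟨by omega, by omega⟩, by omega, by omega⟩, by omega, h5, h3⟩,
        ne_image x y h1 h2 h4⟩
    · obtain ⟨e1, e2⟩ := spec h0
      simp only [hfe, e1, e2, hS', Finset.coe_erase, Set.mem_sdiff, Finset.coe_filter,
        Set.mem_ofPred_eq]
      rw [act_neg] at h3
      rw [if_neg (by omega)]
      simp only [Finset.mem_product, Finset.mem_Icc, neg_neg, act_mul, e1, e2, Set.mem_singleton_iff,
        Prod.mk.injEq]
      rw [act_neg w]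
      exact ⟨⟨⟨⟨by omega, by omega⟩, by omega, by omega⟩, by omega, by omega, by omega⟩, by omega⟩
  · rintro ⟨x, y⟩ hz
    simp only [Finset.coe_erase, hS', Set.mem_sdiff, Finset.coe_filter,
      Set.mem_ofPred_eq, Set.mem_singleton_iff] at hz
    exact hf x y hz.1.2.1 hz.1.2.2.1 hz.2
  · rintro ⟨x, y⟩ hz
    have h4 : (x, y) ≠ ((i : ℤ), (i : ℤ) + 1) := by
      rintro hc
      rw [hc] at hz
      exact hnot hz
    simp only [hS, Finset.coe_filter, Set.mem_ofPred_eq] at hz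
    exact hf x y hz.2.1 hz.2.2.1 h4

theorem asc_mul_simple_iff {k : ℕ} (w : B k) (i : Fin k) :
    act (w * simple i) i < act (w * simple i) ((i : ℤ) + 1) ↔
      act w ((i : ℤ) + 1) < act w i := by
  rw [act_mul, act_mul, act_simple, act_simple]
  by_cases h0 : (i : ℕ) = 0
  · simp [h0, act_neg]
  · simp [h0]

theorem invCount_mul_simple_of_desc {k : ℕ} (w : B k) (i : Fin k)
    (h : act w ((i : ℤ) + 1) < act w i) : invCount (w * simple i) + 1 = invCount w := by
  rw [← invCount_mul_simple _ i ((asc_mul_simple_iff w i).2 h), mul_assoc, simple_mul_self, mul_one]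

theorem asc_or_desc {k : ℕ} (w : B k) (i : Fin k) :
    act w i < act w ((i : ℤ) + 1) ∨ act w ((i : ℤ) + 1) < act w i := by
  apply lt_or_gt_of_ne
  rw [Ne, act_inj]
  omega

theorem invCount_one {k : ℕ} : invCount (1 : B k) = 0 := by
  unfold invCount
  rw [Finset.card_eq_zero, Finset.filter_eq_empty_iff]
  intro z _
  rw [act_one, act_one]
  omega

theorem wordProd_append_singleton {k : ℕ} (l : List (Fin k)) (i : Fin k) :
    wordProd (l ++ [i]) = wordProd l * simple i := by simp [wordProd]

theorem invCount_wordProd_le {k : ℕ} (l : List (Fin k)) : invCount (wordProd l) ≤ l.length := by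
  induction l using List.reverseRecOn with
  | nil => exact invCount_one.le
  | append_singleton l i ih =>
    rw [wordProd_append_singleton, List.length_append, List.length_singleton]
    rcases asc_or_desc (wordProd l) i with h | h
    · rw [invCount_mul_simple _ i h]; omega
    · have := invCount_mul_simple_of_desc _ i h; omega

/-- The values at `0, …, k` increase strictly from `0` and stay at most `k`, which leaves only the
identity. Counting up from `0` bounds them below, counting down from `k` bounds them above. -/
theorem eq_one_of_asc {k : ℕ} (w : B k)
    (h : ∀ i : Fin k, act w i < act w ((i : ℤ) + 1)) : w = 1 := by
  have h1 : ∀ n : ℕ, n ≤ k → (n : ℤ) ≤ act w n := by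
    intro n
    induction n with
    | zero => intro _; simp
    | succ n ih =>
      intro hn
      have := h ⟨n, by omega⟩
      have := ih (by omega)
      push_cast
      simp only at *
      omega
  have h2 : ∀ n : ℕ, n ≤ k → act w ((k : ℤ) - n) ≤ (k : ℤ) - n := by
    intro n
    induction n with
    | zero => intro _; simpa using act_le w le_rfl
    | succ n ih =>
      intro hn
      have h3 := h ⟨k - (n + 1), by omega⟩
      have h4 := ih (by omega)
      have e1 : ((k - (n + 1) : ℕ) : ℤ) = (k : ℤ) - (n + 1 : ℕ) := by omega
      have e2 : ((k - (n + 1) : ℕ) : ℤ) + 1 = (k : ℤ) - n := by omega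
      simp only [e2] at h3
      rw [e1] at h3
      omega
  apply ext_act
  intro x hx
  rw [act_one]
  rcases le_or_gt x k with hk | hk
  · obtain ⟨n, rfl⟩ := Int.eq_ofNat_of_zero_le hx.le
    have a1 := h1 n (by omega)
    have a2 := h2 (k - n) (by omega)
    have e : (k : ℤ) - (k - n : ℕ) = n := by omega
    rw [e] at a2
    exact le_antisymm a2 a1
  · exact act_of_lt w hk

theorem exists_word_length_eq_invCount {k : ℕ} (n : ℕ) : ∀ w : B k, invCount w = n →
    ∃ l : List (Fin k), l.length = n ∧ wordProd l = w := by
  induction n with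
  | zero =>
    intro w hw
    refine ⟨[], rfl, (eq_one_of_asc w fun i => ?_).symm⟩
    rcases asc_or_desc w i with h | h
    · exact h
    · have := invCount_mul_simple_of_desc w i h; omega
  | succ n ih =>
    intro w hw
    by_cases h : ∀ i : Fin k, act w i < act w ((i : ℤ) + 1)
    · rw [eq_one_of_asc w h, invCount_one] at hw
      omega
    · push Not at h
      obtain ⟨i, hi⟩ := h
      have hd : act w ((i : ℤ) + 1) < act w i := by
        rcases asc_or_desc w i with h | h <;> omega
      have := invCount_mul_simple_of_desc w i hd
      obtain ⟨l, hl1, hl2⟩ := ih (w * simple i) (by omega)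
      refine ⟨l ++ [i], by simp [hl1], ?_⟩
      rw [wordProd_append_singleton, hl2, mul_assoc, simple_mul_self, mul_one]

/-- Each letter changes the inversion number by one, so no word is shorter than it; removing
descents until none is left gives a word of exactly that length. -/
theorem length_eq_invCount {k : ℕ} (w : B k) : length w = invCount w := by
  apply le_antisymm
  · exact Nat.sInf_le (exists_word_length_eq_invCount _ w rfl)
  · obtain ⟨l, h1, h2⟩ := exists_isReducedExpr w
    rw [← h2, ← h1]
    exact invCount_wordProd_le l

theorem length_inv_le {k : ℕ} (w : B k) : length w⁻¹ ≤ length w := by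
  obtain ⟨l, h1, h2⟩ := exists_isReducedExpr w
  refine Nat.sInf_le ⟨l.reverse, by simpa using h2, ?_⟩
  rw [← h1]
  exact eq_inv_of_mul_eq_one_left (wordProd_reverse l)

theorem length_inv {k : ℕ} (w : B k) : length w⁻¹ = length w :=
  le_antisymm (length_inv_le w) (by simpa using length_inv_le w⁻¹)

theorem length_mul_simple {k : ℕ} (w : B k) (i : Fin k) (h : act w i < act w ((i : ℤ) + 1)) :
    length (w * simple i) = length w + 1 := by
  rw [length_eq_invCount, length_eq_invCount, invCount_mul_simple w i h]

theorem length_mul_simple_of_desc {k : ℕ} (w : B k) (i : Fin k)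
    (h : act w ((i : ℤ) + 1) < act w i) : length (w * simple i) + 1 = length w := by
  rw [length_eq_invCount, length_eq_invCount, invCount_mul_simple_of_desc w i h]

/-! ### The Hecke relations in usable form. -/

/-- Elements `g i` of an algebra that satisfy the relations of the Hecke algebra of type `B`. -/
structure IsHeckeFamily {k : ℕ} {A : Type*} [Ring A] [Algebra ℂ A] (p q : ℂ) (g : Fin k → A) :
    Prop where
  sq : ∀ i, g i * g i = (1 - if (i : ℕ) = 0 then p else q) • g i +
    (if (i : ℕ) = 0 then p else q) • (1 : A)
  comm : ∀ i j : Fin k, (i : ℕ) + 1 < j → g i * g j = g j * g i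
  braid_three : ∀ i j : Fin k, (i : ℕ) ≠ 0 → (i : ℕ) + 1 = j → g i * g j * g i = g j * g i * g j
  braid_four : ∀ i j : Fin k, (i : ℕ) = 0 → (j : ℕ) = 1 →
    g i * g j * g i * g j = g j * g i * g j * g i

theorem heckeGen_braid {k : ℕ} (p q : ℂ) (i j : Fin k) (h : i ≠ j) :
    ((CoxeterSystem.alternatingWord i j (coxeterMatrix k i j)).map (heckeGen p q)).prod =
    ((CoxeterSystem.alternatingWord j i (coxeterMatrix k i j)).map (heckeGen p q)).prod := by
  have h := RingQuot.mkAlgHom_rel ℂ (HeckeRel.braid (M := coxeterMatrix k)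
    (r := fun i : Fin k => if (i : ℕ) = 0 then p else q) i j h)
  simp only [map_list_prod, List.map_map] at h
  exact h

theorem isHeckeFamily_heckeGen (k : ℕ) (p q : ℂ) :
    IsHeckeFamily (k := k) p q (heckeGen p q) where
  sq i := by
    have h := RingQuot.mkAlgHom_rel ℂ (HeckeRel.quadratic (M := coxeterMatrix k)
      (r := fun i : Fin k => if (i : ℕ) = 0 then p else q) i)
    simp only [map_mul, map_sub, map_add, map_one, map_zero, AlgHom.commutes] at h
    change (heckeGen p q i - 1) * (heckeGen p q i + algebraMap ℂ (Hecke k p q) _) = 0 at h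
    rw [Algebra.algebraMap_eq_smul_one] at h
    generalize (if (i : ℕ) = 0 then p else q) = r at h ⊢
    rw [sub_mul, mul_add, one_mul, mul_smul_comm, mul_one] at h
    linear_combination (norm := module) h
  comm i j h := by
    have hm : coxeterMatrix k i j = 2 := by
      change (if i = j then 1 else _) = 2
      rw [if_neg (by rintro rfl; omega), if_neg (by omega), if_neg (by omega)]
    have := heckeGen_braid p q i j (by rintro rfl; omega)
    simpa [hm, CoxeterSystem.alternatingWord] using this
  braid_three i j hi h := by
    have hm : coxeterMatrix k i j = 3 := by
      change (if i = j then 1 else _) = 3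
      rw [if_neg (by rintro rfl; omega), if_neg (by omega), if_pos (by omega)]
    have := heckeGen_braid p q i j (by rintro rfl; omega)
    -- An alternating word ends in its second letter, so at odd length it also begins with it and
    -- the two sides appear exchanged.
    simpa [hm, CoxeterSystem.alternatingWord, mul_assoc] using this.symm
  braid_four i j hi h := by
    have hm : coxeterMatrix k i j = 4 := by
      change (if i = j then 1 else _) = 4
      rw [if_neg (by rintro rfl; omega), if_pos (by omega)]
    have := heckeGen_braid p q i j (by rintro rfl; omega)
    simpa [hm, CoxeterSystem.alternatingWord, mul_assoc] using this

/-! ### Braid relations among the simple reflections. -/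

theorem act_simple_left {k : ℕ} (i : Fin k) (hi : (i : ℕ) ≠ 0) :
    act (simple i) i = (i : ℤ) + 1 := by
  rw [act_simple, if_neg hi, if_pos rfl]

theorem act_simple_right {k : ℕ} (i : Fin k) (hi : (i : ℕ) ≠ 0) :
    act (simple i) ((i : ℤ) + 1) = i := by
  rw [act_simple, if_neg hi, if_neg (by omega), if_pos rfl]

theorem act_simple_zero {k : ℕ} (i : Fin k) (hi : (i : ℕ) = 0) :
    act (simple i) 1 = -1 := by
  rw [act_simple, if_pos hi, if_pos rfl]

theorem act_simple_of_ne {k : ℕ} (i : Fin k) {x : ℤ} (hx : 0 < x) (h1 : x ≠ i)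
    (h2 : x ≠ (i : ℤ) + 1) : act (simple i) x = x := by
  rw [act_simple]
  split_ifs <;> omega

theorem simple_comm {k : ℕ} (i j : Fin k) (h : (i : ℕ) + 1 < j) :
    simple i * simple j = simple j * simple i := by
  apply ext_act
  intro x hx
  rw [act_mul, act_mul]
  have e1 : (0 < x ∧ (x = j ∨ x = (j : ℤ) + 1)) ∨ act (simple j) x = x := by
    rw [act_simple]; split_ifs <;> omega
  rcases e1 with ⟨-, rfl | rfl⟩ | e1
  · rw [act_simple_left j (by omega), act_simple_of_ne i (by omega) (by omega) (by omega),
      act_simple_of_ne i (by omega) (by omega) (by omega), act_simple_left j (by omega)]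
  · rw [act_simple_right j (by omega), act_simple_of_ne i (by omega) (by omega) (by omega),
      act_simple_of_ne i (by omega) (by omega) (by omega), act_simple_right j (by omega)]
  · rw [e1]
    have e2 : act (simple i) x = x ∨ (-(j : ℤ) < act (simple i) x ∧ act (simple i) x < j) := by
      rw [act_simple]; split_ifs <;> omega
    rcases e2 with e2 | e2
    · rw [e2, e1]
    · generalize act (simple i) x = y at e2
      rw [act_simple]
      split_ifs <;> omega

theorem simple_braid_three {k : ℕ} (i j : Fin k) (hi : (i : ℕ) ≠ 0) (h : (i : ℕ) + 1 = j) :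
    simple i * simple j * simple i = simple j * simple i * simple j := by
  have e1 := act_simple_left i hi
  have e2 := act_simple_right i hi
  have e3 : act (simple i) ((i : ℤ) + 2) = (i : ℤ) + 2 :=
    act_simple_of_ne i (by omega) (by omega) (by omega)
  have f1 : act (simple j) (i : ℤ) = i := act_simple_of_ne j (by omega) (by omega) (by omega)
  have f2 := act_simple_left j (by omega)
  have f3 := act_simple_right j (by omega)
  have hj : (j : ℤ) = (i : ℤ) + 1 := by omega
  rw [hj] at f2 f3
  rw [show (i : ℤ) + 1 + 1 = (i : ℤ) + 2 by ring] at f2 f3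
  apply ext_act
  intro x hx
  rcases eq_or_ne x i with rfl | h1
  · simp only [act_mul, e1, e2, e3, f1, f2, f3]
  rcases eq_or_ne x ((i : ℤ) + 1) with rfl | h2
  · simp only [act_mul, e1, e2, e3, f1, f2, f3]
  rcases eq_or_ne x ((i : ℤ) + 2) with rfl | h3
  · simp only [act_mul, e1, e2, e3, f1, f2, f3]
  have e1 : act (simple i) x = x := act_simple_of_ne i hx h1 h2
  have e2 : act (simple j) x = x := act_simple_of_ne j hx (by omega) (by omega)
  simp only [act_mul, e1, e2]

theorem simple_braid_four {k : ℕ} (i j : Fin k) (hi : (i : ℕ) = 0) (h : (j : ℕ) = 1) :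
    simple i * simple j * simple i * simple j = simple j * simple i * simple j * simple i := by
  apply ext_act
  intro x hx
  rcases eq_or_ne x 1 with rfl | h1
  · simp [act_simple, hi, h]
  rcases eq_or_ne x 2 with rfl | h2
  · simp [act_simple, hi, h]
  have e1 : act (simple i) x = x := act_simple_of_ne i hx (by omega) (by omega)
  have e2 : act (simple j) x = x := act_simple_of_ne j hx (by omega) (by omega)
  simp only [act_mul, e1, e2]

/-! ### Matsumoto's theorem: independence of the reduced word. -/

section Matsumoto

variable {k : ℕ} {A : Type*} [Ring A] [Algebra ℂ A] {p q : ℂ}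

/-- The product of `g` along the chosen reduced expression of `w`. -/
def prodAlong (g : Fin k → A) (w : B k) : A := ((exists_isReducedExpr w).choose.map g).prod

theorem prodAlong_one (g : Fin k → A) : prodAlong g 1 = 1 := by
  have h := (exists_isReducedExpr (1 : B k)).choose_spec.2
  rw [length_eq_invCount, invCount_one, List.length_eq_zero_iff] at h
  rw [prodAlong, h, List.map_nil, List.prod_nil]

theorem isReduced_of_append {l : List (Fin k)} {i : Fin k}
    (h : (l ++ [i]).length = length (wordProd (l ++ [i]))) :
    l.length = length (wordProd l) ∧
      act (wordProd l) i < act (wordProd l) ((i : ℤ) + 1) := by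
  rw [wordProd_append_singleton, List.length_append, List.length_singleton] at h
  have h1 := invCount_wordProd_le l
  rw [← length_eq_invCount] at h1
  rcases asc_or_desc (wordProd l) i with h2 | h2
  · have := length_mul_simple _ i h2
    exact ⟨by omega, h2⟩
  · have := length_mul_simple_of_desc _ i h2
    omega

/-- The bound `n` on the hypothesis `H` lets this serve inside the induction on length that later
proves `H` without a bound. -/
theorem prod_map_eq_prodAlong_of (g : Fin k → A) (n : ℕ)
    (H : ∀ (y : B k) (i : Fin k), act y i < act y ((i : ℤ) + 1) → length y < n →
      prodAlong g (y * simple i) = prodAlong g y * g i) (l : List (Fin k))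
    (hl : l.length = length (wordProd l)) (hn : l.length ≤ n) :
    (l.map g).prod = prodAlong g (wordProd l) := by
  induction l using List.reverseRecOn with
  | nil => exact (prodAlong_one g).symm
  | append_singleton l i ih =>
    obtain ⟨h1, h2⟩ := isReduced_of_append hl
    rw [List.length_append, List.length_singleton] at hn
    rw [wordProd_append_singleton, H _ i h2 (by omega), ← ih h1 (by omega)]
    simp

/-- Two right descents of `w` give the same product, by the braid relation between them. -/
theorem prodAlong_braid {g : Fin k → A} (hg : IsHeckeFamily p q g) (n : ℕ)
    (H : ∀ (y : B k) (i : Fin k), act y i < act y ((i : ℤ) + 1) → length y < n →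
      prodAlong g (y * simple i) = prodAlong g y * g i) (w : B k) (hw : length w = n + 1)
    (i j : Fin k) (hij : (i : ℕ) < j) (hi : act w ((i : ℤ) + 1) < act w i)
    (hj : act w ((j : ℤ) + 1) < act w j) :
    prodAlong g (w * simple i) * g i = prodAlong g (w * simple j) * g j := by
  -- `D` strips a right descent off an element short enough for `H`. Stripping alternately from `w *
  -- simple i` and from `w * simple j` reaches the same element, leaving the two sides of the braid
  -- relation as tails.
  have D : ∀ (y : B k) (a : Fin k), length y ≤ n → act y ((a : ℤ) + 1) < act y a →
      prodAlong g y = prodAlong g (y * simple a) * g a ∧ length (y * simple a) ≤ n := by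
    intro y a hy hd
    have h1 := length_mul_simple_of_desc y a hd
    have h2 := H (y * simple a) a ((asc_mul_simple_iff y a).2 hd) (by omega)
    rw [mul_assoc, simple_mul_self, mul_one] at h2
    exact ⟨h2, by omega⟩
  have hwi := length_mul_simple_of_desc w i hi
  have hwj := length_mul_simple_of_desc w j hj
  rcases eq_or_ne ((i : ℕ) + 1) j with h | h
  · have hjc : (j : ℤ) = (i : ℤ) + 1 := by omega
    by_cases h0 : (i : ℕ) = 0
    · have hj1 : (j : ℕ) = 1 := by omega
      have hjc : (j : ℤ) = 1 := by omega
      have hic : (i : ℤ) = 0 := by omega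
      rw [hic, zero_add, act_zero] at hi
      rw [hjc, show (1 : ℤ) + 1 = 2 by norm_num] at hj
      have a1 : act (simple i) 1 = -1 := act_simple_zero i h0
      have a2 : act (simple i) 2 = 2 := act_simple_of_ne i (by omega) (by omega) (by omega)
      have b1 : act (simple j) 1 = 2 := by
        have := act_simple_left j (by omega); rw [hjc] at this; exact this
      have b2 : act (simple j) 2 = 1 := by
        have := act_simple_right j (by omega); rw [hjc] at this; exact this
      have ei : ∀ y : B k, act y 1 < 0 → act y ((i : ℤ) + 1) < act y i := by
        intro y hy; rw [hic, zero_add, act_zero]; exact hy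
      have ej : ∀ y : B k, act y 2 < act y 1 → act y ((j : ℤ) + 1) < act y j := by
        intro y hy; rw [hjc]; exact hy
      obtain ⟨c1, l1⟩ := D (w * simple i) j (by omega) (ej _ (by
        simp only [act_mul, a1, a2, b1, b2, act_neg]; omega))
      obtain ⟨c2, l2⟩ := D _ i l1 (ei _ (by
        simp only [act_mul, a1, a2, b1, b2, act_neg]; omega))
      obtain ⟨c3, l3⟩ := D _ j l2 (ej _ (by
        simp only [act_mul, a1, a2, b1, b2, act_neg]; omega))
      obtain ⟨d1, m1⟩ := D (w * simple j) i (by omega) (ei _ (by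
        simp only [act_mul, a1, a2, b1, b2, act_neg]; omega))
      obtain ⟨d2, m2⟩ := D _ j m1 (ej _ (by
        simp only [act_mul, a1, a2, b1, b2, act_neg]; omega))
      obtain ⟨d3, m3⟩ := D _ i m2 (ei _ (by
        simp only [act_mul, a1, a2, b1, b2, act_neg]; omega))
      have hb := hg.braid_four i j h0 hj1
      have hs := simple_braid_four i j h0 hj1
      rw [c1, c2, c3, d1, d2, d3]
      simp only [mul_assoc] at hb hs ⊢
      rw [hs, hb]
    · rw [hjc, show (i : ℤ) + 1 + 1 = i + 2 by ring] at hj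
      have a1 := act_simple_left i h0
      have a2 := act_simple_right i h0
      have a3 : act (simple i) ((i : ℤ) + 2) = (i : ℤ) + 2 :=
        act_simple_of_ne i (by omega) (by omega) (by omega)
      have b1 : act (simple j) (i : ℤ) = i := act_simple_of_ne j (by omega) (by omega) (by omega)
      have b2 := act_simple_left j (by omega)
      have b3 := act_simple_right j (by omega)
      rw [hjc] at b2 b3
      rw [show (i : ℤ) + 1 + 1 = (i : ℤ) + 2 by ring] at b2 b3
      have ej : ∀ y : B k, act y ((i : ℤ) + 2) < act y ((i : ℤ) + 1) →
          act y ((j : ℤ) + 1) < act y j := by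
        intro y hy; rw [hjc, show (i : ℤ) + 1 + 1 = i + 2 by ring]; exact hy
      obtain ⟨c1, l1⟩ := D (w * simple i) j (by omega) (ej _ (by
        simp only [act_mul, a1, a2, a3]; omega))
      obtain ⟨c2, l2⟩ := D _ i l1 (by
        simp only [act_mul, a1, a2, a3, b1, b2, b3]; omega)
      obtain ⟨d1, m1⟩ := D (w * simple j) i (by omega) (by
        simp only [act_mul, b1, b2]; omega)
      obtain ⟨d2, m2⟩ := D _ j m1 (ej _ (by
        simp only [act_mul, a1, a2, a3, b1, b2, b3]; omega))
      have hb := hg.braid_three i j h0 h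
      have hs := simple_braid_three i j h0 h
      rw [c1, c2, d1, d2]
      simp only [mul_assoc] at hb hs ⊢
      rw [hs, hb]
  · have hc : (i : ℕ) + 1 < j := by omega
    have b1 : act (simple j) (i : ℤ) = i := by
      rw [act_simple]; split_ifs <;> omega
    have b2 : act (simple j) ((i : ℤ) + 1) = (i : ℤ) + 1 :=
      act_simple_of_ne j (by omega) (by omega) (by omega)
    have a1 : act (simple i) (j : ℤ) = j := act_simple_of_ne i (by omega) (by omega) (by omega)
    have a2 : act (simple i) ((j : ℤ) + 1) = (j : ℤ) + 1 :=
      act_simple_of_ne i (by omega) (by omega) (by omega)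
    obtain ⟨c1, -⟩ := D (w * simple i) j (by omega) (by rw [act_mul, act_mul, a1, a2]; exact hj)
    obtain ⟨d1, -⟩ := D (w * simple j) i (by omega) (by rw [act_mul, act_mul, b1, b2]; exact hi)
    rw [c1, d1, mul_assoc, mul_assoc, mul_assoc, mul_assoc, hg.comm i j hc, simple_comm i j hc]

/-- The chosen word of `y * simple i` may end in another letter `j`, but then `i` and `j` are both
right descents, and `prodAlong_braid` trades one for the other. -/
theorem prodAlong_mul_simple {g : Fin k → A} (hg : IsHeckeFamily p q g) (y : B k) (i : Fin k)
    (h : act y i < act y ((i : ℤ) + 1)) :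
    prodAlong g (y * simple i) = prodAlong g y * g i := by
  induction hn : length y using Nat.strong_induction_on generalizing y i with
  | _ n IH =>
    have H : ∀ (y : B k) (i : Fin k), act y i < act y ((i : ℤ) + 1) → length y < n →
      prodAlong g (y * simple i) = prodAlong g y * g i := fun y i hy hl => IH _ hl y i hy rfl
    have hlen := length_mul_simple y i h
    have hwi : y * simple i * simple i = y := by rw [mul_assoc, simple_mul_self, mul_one]
    have hdi : act (y * simple i) ((i : ℤ) + 1) < act (y * simple i) i := by
      rw [← asc_mul_simple_iff, hwi]; exact h
    obtain ⟨hl1, hl2⟩ := (exists_isReducedExpr (y * simple i)).choose_spec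
    have hT : ((exists_isReducedExpr (y * simple i)).choose.map g).prod =
      prodAlong g (y * simple i) := rfl
    generalize (exists_isReducedExpr (y * simple i)).choose = l at hl1 hl2 hT
    rcases List.eq_nil_or_concat' l with rfl | ⟨l', j, rfl⟩
    · rw [List.length_nil] at hl2
      omega
    · rw [← hl1] at hl2
      obtain ⟨h1, h2⟩ := isReduced_of_append hl2
      rw [hl1, List.length_append, List.length_singleton] at hl2
      have h3 := prod_map_eq_prodAlong_of g n H l' h1 (by omega)
      rw [wordProd_append_singleton] at hl1
      have hl' : y * simple i * simple j = wordProd l' := by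
        rw [← hl1, mul_assoc, simple_mul_self, mul_one]
      have h4 : prodAlong g (y * simple i) = prodAlong g (y * simple i * simple j) * g j := by
        rw [← hT, hl', ← h3]
        simp
      have hdj : act (y * simple i) ((j : ℤ) + 1) < act (y * simple i) j := by
        rw [← asc_mul_simple_iff, hl']; exact h2
      rw [h4]
      rcases lt_trichotomy (i : ℕ) j with hij | hij | hij
      · rw [← prodAlong_braid hg n H _ (by omega) i j hij hdi hdj, hwi]
      · rw [← Fin.ext hij, hwi]
      · rw [prodAlong_braid hg n H _ (by omega) j i hij hdj hdi, hwi]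

theorem prod_map_eq_prodAlong {g : Fin k → A} (hg : IsHeckeFamily p q g) (l : List (Fin k))
    (hl : l.length = length (wordProd l)) : (l.map g).prod = prodAlong g (wordProd l) :=
  prod_map_eq_prodAlong_of g l.length (fun y i h _ => prodAlong_mul_simple hg y i h) l hl le_rfl

theorem length_simple_mul (y : B k) (i : Fin k) (h : act y⁻¹ i < act y⁻¹ ((i : ℤ) + 1)) :
    length (simple i * y) = length y + 1 := by
  rw [← length_inv, mul_inv_rev, simple_inv, length_mul_simple _ i h, length_inv]

/-- Prepending a letter to a reduced word of `y` keeps it reduced, so independence of the reduced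
word applies. -/
theorem prodAlong_simple_mul {g : Fin k → A} (hg : IsHeckeFamily p q g) (y : B k) (i : Fin k)
    (h : act y⁻¹ i < act y⁻¹ ((i : ℤ) + 1)) :
    prodAlong g (simple i * y) = g i * prodAlong g y := by
  obtain ⟨l, h1, h2⟩ := exists_isReducedExpr y
  have hw : wordProd (i :: l) = simple i * y := by rw [← h1]; simp [wordProd]
  have h3 := prod_map_eq_prodAlong hg (i :: l) (by
    rw [hw, length_simple_mul y i h, List.length_cons, h2])
  have h4 := prod_map_eq_prodAlong hg l (by rw [h2, h1])
  rw [hw] at h3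
  rw [← h3, ← h1, ← h4]
  simp

end Matsumoto

/-! ### Longest representatives, cycles and reflections. -/

/-- The signed permutation `i ↦ i - n - 1` of `{1, …, n}`, which fixes all `i > n`. -/
def longRep (k n : ℕ) : B k :=
  if hn : n ≤ k then
    ofPerm
      { toFun := fun x : ℤ => if 1 ≤ x ∧ x ≤ n then x - n - 1
          else if -(n : ℤ) ≤ x ∧ x ≤ -1 then x + n + 1 else x
        invFun := fun x : ℤ => if 1 ≤ x ∧ x ≤ n then x - n - 1
          else if -(n : ℤ) ≤ x ∧ x ≤ -1 then x + n + 1 else x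
        left_inv := by intro x; dsimp only; split_ifs <;> omega
        right_inv := by intro x; dsimp only; split_ifs <;> omega }
      (by intro x; dsimp only [Equiv.coe_fn_mk]; split_ifs <;> omega)
      (by intro x hx; dsimp only [Equiv.coe_fn_mk]; split_ifs <;> omega)
  else 1

theorem act_longRep {k n : ℕ} (hn : n ≤ k) (x : ℤ) : act (longRep k n) x =
    if 1 ≤ x ∧ x ≤ n then x - n - 1 else if -(n : ℤ) ≤ x ∧ x ≤ -1 then x + n + 1 else x := by
  rw [longRep, dif_pos hn, act_ofPerm]
  rfl

/-- The cycle that sends `n + 1` to `j` and `i` to `i + 1` for `j ≤ i ≤ n`. -/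
def cyc (k n j : ℕ) : B k :=
  if h : 1 ≤ j ∧ j ≤ n + 1 ∧ n + 1 ≤ k then
    ofPerm
      { toFun := fun x : ℤ => if x = n + 1 then (j : ℤ) else if j ≤ x ∧ x ≤ n then x + 1
          else if x = -(n + 1) then -(j : ℤ) else if -(n : ℤ) ≤ x ∧ x ≤ -j then x - 1 else x
        invFun := fun x : ℤ => if x = j then (n : ℤ) + 1 else if j + 1 ≤ x ∧ x ≤ n + 1 then x - 1
          else if x = -j then -((n : ℤ) + 1)
          else if -((n : ℤ) + 1) ≤ x ∧ x ≤ -(j + 1) then x + 1 else x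
        left_inv := by intro x; dsimp only; split_ifs <;> omega
        right_inv := by intro x; dsimp only; split_ifs <;> omega }
      (by intro x; dsimp only [Equiv.coe_fn_mk]; split_ifs <;> omega)
      (by intro x hx; dsimp only [Equiv.coe_fn_mk]; split_ifs <;> omega)
  else 1

theorem act_cyc {k n j : ℕ} (h : 1 ≤ j ∧ j ≤ n + 1 ∧ n + 1 ≤ k) (x : ℤ) : act (cyc k n j) x =
    if x = n + 1 then (j : ℤ) else if j ≤ x ∧ x ≤ n then x + 1
      else if x = -(n + 1) then -(j : ℤ) else if -(n : ℤ) ≤ x ∧ x ≤ -j then x - 1 else x := by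
  rw [cyc, dif_pos h, act_ofPerm]
  rfl

theorem act_cyc_inv {k n j : ℕ} (h : 1 ≤ j ∧ j ≤ n + 1 ∧ n + 1 ≤ k) (x : ℤ) :
    act (cyc k n j)⁻¹ x = if x = j then (n : ℤ) + 1 else if j + 1 ≤ x ∧ x ≤ n + 1 then x - 1
      else if x = -j then -((n : ℤ) + 1)
      else if -((n : ℤ) + 1) ≤ x ∧ x ≤ -(j + 1) then x + 1 else x := by
  rw [← act_inj (cyc k n j), act_act_inv, act_cyc h]
  split_ifs <;> omega

/-- The reflection that exchanges `x` and `y`, and `-x` and `-y`. -/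
def srefl (k : ℕ) (x y : ℤ) : B k :=
  if h : (x ≠ 0 ∧ -(k : ℤ) ≤ x ∧ x ≤ k) ∧ (y ≠ 0 ∧ -(k : ℤ) ≤ y ∧ y ≤ k) then
    ofPerm
      { toFun := fun z : ℤ => if z = x then y else if z = y then x
          else if z = -x then -y else if z = -y then -x else z
        invFun := fun z : ℤ => if z = x then y else if z = y then x
          else if z = -x then -y else if z = -y then -x else z
        left_inv := by intro z; dsimp only; split_ifs <;> omega
        right_inv := by intro z; dsimp only; split_ifs <;> omega }
      (by intro z; dsimp only [Equiv.coe_fn_mk]; split_ifs <;> omega)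
      (by intro z hz; dsimp only [Equiv.coe_fn_mk]; split_ifs <;> omega)
  else 1

theorem act_srefl {k : ℕ} {x y : ℤ}
    (h : (x ≠ 0 ∧ -(k : ℤ) ≤ x ∧ x ≤ k) ∧ (y ≠ 0 ∧ -(k : ℤ) ≤ y ∧ y ≤ k)) (z : ℤ) :
    act (srefl k x y) z = if z = x then y else if z = y then x
      else if z = -x then -y else if z = -y then -x else z := by
  rw [srefl, dif_pos h, act_ofPerm]
  rfl

theorem act_mem {k : ℕ} (w : B k) {x : ℤ} (h : x ≠ 0 ∧ -(k : ℤ) ≤ x ∧ x ≤ k) :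
    act w x ≠ 0 ∧ -(k : ℤ) ≤ act w x ∧ act w x ≤ k :=
  ⟨act_ne_zero w h.1, le_act w h.2.1, act_le w h.2.2⟩

theorem conj_srefl {k : ℕ} (w : B k) {x y : ℤ}
    (h : (x ≠ 0 ∧ -(k : ℤ) ≤ x ∧ x ≤ k) ∧ (y ≠ 0 ∧ -(k : ℤ) ≤ y ∧ y ≤ k)) :
    w * srefl k x y * w⁻¹ = srefl k (act w x) (act w y) := by
  apply ext_act
  intro z hz
  obtain ⟨z, rfl⟩ := (act w).surjective z
  rw [act_mul, act_mul, act_inv_act, act_srefl h, act_srefl ⟨act_mem w h.1, act_mem w h.2⟩,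
    ← act_neg, ← act_neg]
  simp only [act_inj, apply_ite (act w)]

theorem simple_eq_srefl {k : ℕ} (i : Fin k) (hi : (i : ℕ) ≠ 0) :
    simple i = srefl k i ((i : ℤ) + 1) := by
  apply ext_act
  intro x hx
  rw [act_simple, act_srefl (by omega), if_neg hi]

theorem simple_eq_srefl_zero {k : ℕ} (i : Fin k) (hi : (i : ℕ) = 0) :
    simple i = srefl k 1 (-1) := by
  apply ext_act
  intro x hx
  rw [act_simple, act_srefl (by omega), if_pos hi]
  split_ifs <;> omega

/-- Together with `cyc_last` this identifies `cyc k n j` as `s_j s_{j+1} ⋯ s_n`. -/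
theorem simple_mul_cyc {k n : ℕ} (i : Fin k) (h : 1 ≤ (i : ℕ) ∧ i ≤ n ∧ n + 1 ≤ k) :
    simple i * cyc k n (i + 1) = cyc k n i := by
  apply ext_act
  intro x hx
  rw [act_mul, act_cyc (by omega), act_cyc (by omega)]
  rcases eq_or_ne x (n + 1) with rfl | h1
  · rw [if_pos rfl, if_pos rfl]
    exact_mod_cast act_simple_right i (by omega)
  · rw [if_neg h1, if_neg h1]
    rcases eq_or_ne x i with rfl | h2
    · rw [if_neg (by omega), if_neg (by omega), if_neg (by omega), if_pos (by omega),
        act_simple_left i (by omega)]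
    · by_cases h3 : (i : ℤ) ≤ x ∧ x ≤ n
      · rw [if_pos (by omega), if_pos h3, act_simple_of_ne i (by omega) (by omega) (by omega)]
      · rw [if_neg (by omega), if_neg h3, if_neg (by omega), if_neg (by omega), if_neg (by omega),
          if_neg (by omega), act_simple_of_ne i hx (by omega) (by omega)]

theorem cyc_last {k n : ℕ} (h : n + 1 ≤ k) : cyc k n (n + 1) = 1 := by
  apply ext_act
  intro x hx
  rw [act_cyc (by omega), act_one]
  split_ifs <;> omega

theorem cyc_inv_mul_simple {k n : ℕ} (i : Fin k) (h : 1 ≤ (i : ℕ) ∧ i ≤ n ∧ n + 1 ≤ k) :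
    (cyc k n (i + 1))⁻¹ * simple i = (cyc k n i)⁻¹ := by
  rw [← simple_mul_cyc i h, mul_inv_rev, simple_inv]

theorem longRep_inv {k n : ℕ} (hn : n ≤ k) : (longRep k n)⁻¹ = longRep k n := by
  apply inv_eq_of_mul_eq_one_left
  apply ext_act
  intro x hx
  rw [act_mul, act_longRep hn, act_longRep hn, act_one]
  split_ifs <;> omega

theorem longRep_succ {k n : ℕ} (t : Fin k) (ht : (t : ℕ) = 0) (hn : n + 1 ≤ k) :
    longRep k (n + 1) = simple t * (cyc k n 1 * longRep k n) := by
  apply ext_act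
  intro x hx
  have e0 : act (longRep k (n + 1)) x = if x ≤ n + 1 then x - n - 2 else x := by
    rw [act_longRep hn]; push_cast; split_ifs <;> omega
  have e1 : act (longRep k n) x = if x ≤ n then x - n - 1 else x := by
    rw [act_longRep (by omega)]; split_ifs <;> omega
  have e2 : act (cyc k n 1) (act (longRep k n) x) =
      if x ≤ n then x - n - 2 else if x = n + 1 then 1 else x := by
    rw [e1, act_cyc (by omega)]; split_ifs <;> omega
  rw [act_mul, act_mul, e0, e2, act_simple, if_pos ht]
  split_ifs <;> omega

theorem longRep_zero (k : ℕ) : longRep k 0 = 1 := by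
  apply ext_act
  intro x hx
  rw [act_longRep (by omega), act_one, if_neg (by omega), if_neg (by omega)]

/-! ### The recursion for the square, and conjugation by one generator. -/

section Hecke

variable {k : ℕ} {A : Type*} [Ring A] [Algebra ℂ A] {p q : ℂ} {g : Fin k → A}

theorem prodAlong_cyc (hg : IsHeckeFamily p q g) {n : ℕ} (i : Fin k)
    (h : 1 ≤ (i : ℕ) ∧ i ≤ n ∧ n + 1 ≤ k) :
    prodAlong g (cyc k n i) = g i * prodAlong g (cyc k n (i + 1)) := by
  rw [← simple_mul_cyc i h]
  apply prodAlong_simple_mul hg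
  rw [act_cyc_inv (by omega), act_cyc_inv (by omega), if_neg (by omega), if_neg (by omega),
    if_neg (by omega), if_neg (by omega), if_pos (by push_cast; rfl)]
  omega

theorem prodAlong_cyc_inv (hg : IsHeckeFamily p q g) {n : ℕ} (i : Fin k)
    (h : 1 ≤ (i : ℕ) ∧ i ≤ n ∧ n + 1 ≤ k) :
    prodAlong g (cyc k n i)⁻¹ = prodAlong g (cyc k n (i + 1))⁻¹ * g i := by
  rw [← cyc_inv_mul_simple i h]
  apply prodAlong_mul_simple hg
  rw [act_cyc_inv (by omega), act_cyc_inv (by omega), if_neg (by omega), if_neg (by omega),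
    if_neg (by omega), if_neg (by omega), if_pos (by push_cast; rfl)]
  omega

/-- The value at `i` is at most `0`, while `i + 1` is carried to `n + 1`, which `longRep k n` fixes.
Allowing `i = 0` covers the final factor `t` as well. -/
theorem asc_longRep_mul_cyc_inv {n : ℕ} (i : Fin k) (h : (i : ℕ) ≤ n ∧ n + 1 ≤ k) :
    act (longRep k n * (cyc k n (i + 1))⁻¹) i <
      act (longRep k n * (cyc k n (i + 1))⁻¹) ((i : ℤ) + 1) := by
  have e1 : act (cyc k n (i + 1))⁻¹ (i : ℤ) = i := by
    rw [act_cyc_inv (by omega)]; split_ifs <;> omega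
  have e2 : act (cyc k n (i + 1))⁻¹ ((i : ℤ) + 1) = n + 1 := by
    rw [act_cyc_inv (by omega), if_pos (by push_cast; rfl)]
  rw [act_mul, act_mul, e1, e2, act_longRep (by omega), act_longRep (by omega)]
  split_ifs <;> omega

/-- Lengths add letter by letter as `j` descends from `n + 1`. The two group elements are inverse to
each other, so one ascent serves both claims. -/
theorem prodAlong_cyc_mul_longRep (hg : IsHeckeFamily p q g) {n : ℕ} (hn : n + 1 ≤ k) (d : ℕ) :
    ∀ j : ℕ, 1 ≤ j → j + d = n + 1 →
    prodAlong g (cyc k n j * longRep k n) = prodAlong g (cyc k n j) * prodAlong g (longRep k n) ∧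
    prodAlong g (longRep k n * (cyc k n j)⁻¹) =
      prodAlong g (longRep k n) * prodAlong g (cyc k n j)⁻¹ := by
  induction d with
  | zero =>
    intro j hj hd
    obtain rfl : j = n + 1 := by omega
    simp [cyc_last hn, prodAlong_one]
  | succ d ih =>
    intro j hj hd
    obtain ⟨ih1, ih2⟩ := ih (j + 1) (by omega) (by omega)
    obtain ⟨i, rfl⟩ : ∃ i : Fin k, (i : ℕ) = j := ⟨⟨j, by omega⟩, rfl⟩
    have hasc := asc_longRep_mul_cyc_inv (n := n) i (by omega)
    constructor
    · rw [prodAlong_cyc hg i (by omega), ← simple_mul_cyc i (by omega), mul_assoc, mul_assoc, ← ih1]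
      apply prodAlong_simple_mul hg
      rw [mul_inv_rev, longRep_inv (by omega)]
      exact hasc
    · rw [prodAlong_cyc_inv hg i (by omega), ← cyc_inv_mul_simple i (by omega), ← mul_assoc,
        ← mul_assoc, ← ih2]
      exact prodAlong_mul_simple hg _ i hasc

theorem prodAlong_longRep_succ_sq (hg : IsHeckeFamily p q g) {n : ℕ} (hn : n + 1 ≤ k)
    (t : Fin k) (ht : (t : ℕ) = 0) :
    prodAlong g (longRep k (n + 1)) ^ 2 =
      g t * (prodAlong g (cyc k n 1) * prodAlong g (longRep k n) ^ 2 *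
        prodAlong g (cyc k n 1)⁻¹) * g t := by
  obtain ⟨h1, h2⟩ := prodAlong_cyc_mul_longRep hg hn n 1 le_rfl (by omega)
  have hasc := asc_longRep_mul_cyc_inv (n := n) t (by omega)
  rw [ht] at hasc
  have e1 : prodAlong g (longRep k (n + 1)) =
      g t * (prodAlong g (cyc k n 1) * prodAlong g (longRep k n)) := by
    rw [longRep_succ t ht hn, ← h1]
    apply prodAlong_simple_mul hg
    rw [mul_inv_rev, longRep_inv (by omega), ht]
    exact hasc
  have e2 : prodAlong g (longRep k (n + 1)) =
      prodAlong g (longRep k n) * prodAlong g (cyc k n 1)⁻¹ * g t := by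
    rw [← longRep_inv hn, longRep_succ t ht hn, mul_inv_rev, mul_inv_rev, simple_inv,
      longRep_inv (by omega), ← h2]
    apply prodAlong_mul_simple hg
    rw [ht]
    exact hasc
  rw [sq]
  -- The left copy is expanded from the left and the right copy from the right, so that the two
  -- shorter elements meet in the middle.
  nth_rw 1 [e1]
  rw [e2, sq]
  simp only [mul_assoc]

/-- Here `simple i` commutes with `u`, so both factors can be collected on the right, where the
quadratic relation applies. For `i = 0` the first fixed-point condition is automatic. -/
theorem conj_prodAlong_of_fix (hg : IsHeckeFamily p q g) (u : B k) (i : Fin k)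
    (h1 : act u i = i) (h2 : act u ((i : ℤ) + 1) = (i : ℤ) + 1) :
    g i * prodAlong g u * g i = (if (i : ℕ) = 0 then p else q) • prodAlong g u +
      (1 - if (i : ℕ) = 0 then p else q) • prodAlong g (u * simple i) := by
  have h1' : act u⁻¹ i = i := by rw [← act_inj u, act_act_inv, h1]
  have h2' : act u⁻¹ ((i : ℤ) + 1) = (i : ℤ) + 1 := by rw [← act_inj u, act_act_inv, h2]
  have hc : simple i * u = u * simple i := by
    rw [eq_comm, ← mul_inv_eq_iff_eq_mul]
    by_cases hi : (i : ℕ) = 0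
    · rw [hi, Nat.cast_zero, zero_add] at h2
      rw [simple_eq_srefl_zero i hi, conj_srefl u (by omega), act_neg, h2]
    · rw [simple_eq_srefl i hi, conj_srefl u (by omega), h1, h2]
  have e1 := prodAlong_mul_simple hg u i (by rw [h1, h2]; omega)
  have e2 := prodAlong_simple_mul hg u i (by rw [h1', h2']; omega)
  rw [← e2, hc, e1, mul_assoc, hg.sq, mul_add, mul_smul_comm, mul_smul_comm, mul_one, add_comm]

/-- The inequalities say that the length rises at each of the two multiplications; `u` being an
involution turns its right ascent into a left one. -/
theorem conj_prodAlong_of_asc (hg : IsHeckeFamily p q g) (u : B k) (i : Fin k) (hu : u⁻¹ = u)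
    (h1 : act u i < act u ((i : ℤ) + 1))
    (h2 : act (simple i) (act u i) < act (simple i) (act u ((i : ℤ) + 1))) :
    g i * prodAlong g u * g i = prodAlong g (simple i * u * simple i) := by
  rw [prodAlong_mul_simple hg _ i (by rw [act_mul, act_mul]; exact h2),
    prodAlong_simple_mul hg u i (by rw [hu]; exact h1)]

end Hecke

/-! ### Conjugating a good involution by the whole cycle. -/

/-- A good involution that fixes all `i > n`. -/
def IsGoodAt {k : ℕ} (n : ℕ) (w : B k) : Prop :=
  (∀ x, act w (act w x) = x) ∧ (∀ x, 0 < x → act w x = x ∨ act w x < 0) ∧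
    ∀ x, (n : ℤ) < x → act w x = x

/-- The fixed points of `w` in the interval `[i, n]`. -/
def fixFrom {k : ℕ} (w : B k) (i n : ℤ) : Finset ℤ := (Finset.Icc i n).filter fun x => act w x = x

theorem mem_fixFrom {k : ℕ} {w : B k} {i n x : ℤ} :
    x ∈ fixFrom w i n ↔ (i ≤ x ∧ x ≤ n) ∧ act w x = x := by
  rw [fixFrom, Finset.mem_filter, Finset.mem_Icc]

theorem fixFrom_of_fix {k : ℕ} {w : B k} {i n : ℤ} (hi : i ≤ n) (h : act w i = i) :
    fixFrom w i n = insert i (fixFrom w (i + 1) n) := by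
  ext x
  rw [Finset.mem_insert, mem_fixFrom, mem_fixFrom]
  rcases eq_or_ne x i with rfl | hx
  · simp [h, hi]
  · simp only [hx, false_or]; constructor <;> rintro ⟨h1, h2⟩ <;> exact ⟨by omega, h2⟩

theorem fixFrom_of_not_fix {k : ℕ} {w : B k} {i n : ℤ} (h : act w i ≠ i) :
    fixFrom w i n = fixFrom w (i + 1) n := by
  ext x
  rw [mem_fixFrom, mem_fixFrom]
  constructor <;> rintro ⟨h1, h2⟩
  · refine ⟨⟨?_, h1.2⟩, h2⟩
    rcases eq_or_ne x i with rfl | hx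
    · exact absurd h2 h
    · omega
  · exact ⟨by omega, h2⟩

theorem notMem_fixFrom_succ {k : ℕ} (w : B k) (i n : ℤ) : i ∉ fixFrom w (i + 1) n := by
  rw [mem_fixFrom]; omega

theorem inv_eq_self_of_act {k : ℕ} {w : B k} (h : ∀ x, act w (act w x) = x) : w⁻¹ = w := by
  apply inv_eq_of_mul_eq_one_left
  apply ext_act
  intro x _
  rw [act_mul, act_one, h]

theorem srefl_inv (k : ℕ) (x y : ℤ) : (srefl k x y)⁻¹ = srefl k x y := by
  by_cases h : (x ≠ 0 ∧ -(k : ℤ) ≤ x ∧ x ≤ k) ∧ (y ≠ 0 ∧ -(k : ℤ) ≤ y ∧ y ≤ k)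
  · apply inv_eq_self_of_act
    intro z
    rw [act_srefl h, act_srefl h]
    split_ifs <;> omega
  · rw [srefl, dif_neg h, inv_one]

theorem mul_srefl_comm {k : ℕ} (u : B k) {x y : ℤ}
    (h : (x ≠ 0 ∧ -(k : ℤ) ≤ x ∧ x ≤ k) ∧ (y ≠ 0 ∧ -(k : ℤ) ≤ y ∧ y ≤ k))
    (hx : act u x = x) (hy : act u y = y) : u * srefl k x y = srefl k x y * u := by
  rw [← mul_inv_eq_iff_eq_mul, conj_srefl u h, hx, hy]

theorem act_simple_neg {k : ℕ} (i : Fin k) (hi : (i : ℕ) ≠ 0) {x : ℤ} (hx : x < 0) :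
    act (simple i) x < 0 := by
  rw [act_simple]; split_ifs <;> omega

theorem act_cyc_neg {k n j : ℕ} (h : 1 ≤ j ∧ j ≤ n + 1 ∧ n + 1 ≤ k) {x : ℤ} (hx : x < 0) :
    act (cyc k n j) x < 0 := by
  rw [act_cyc h]; split_ifs <;> omega

section Hecke

variable {k : ℕ} {A : Type*} [Ring A] [Algebra ℂ A] {p q : ℂ} {g : Fin k → A}

/-- Going down from `j = n + 1`, each fixed point `m` of `w` splits the main term once: a factor `q`
stays on it, and a new term with factor `1 - q` leaves. The power of `q` in that term counts the
fixed points above `m`, which the main term had already passed. -/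
theorem conj_cyc_prodAlong (hg : IsHeckeFamily p q g) {n : ℕ} (hn : n + 1 ≤ k) {w : B k}
    (hw : IsGoodAt n w) (d : ℕ) : ∀ j : ℕ, 1 ≤ j → j + d = n + 1 →
    prodAlong g (cyc k n j) * prodAlong g w * prodAlong g (cyc k n j)⁻¹ =
      q ^ (fixFrom w j n).card • prodAlong g (cyc k n j * w * (cyc k n j)⁻¹) +
      ∑ m ∈ fixFrom w j n, ((1 - q) * q ^ (fixFrom w (m + 1) n).card) •
        prodAlong g (cyc k n j * w * (cyc k n j)⁻¹ * srefl k j (m + 1)) := by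
  obtain ⟨hw1, hw2, hw3⟩ := hw
  induction d with
  | zero =>
    intro j hj hd
    obtain rfl : j = n + 1 := by omega
    have : fixFrom w ((n + 1 : ℕ) : ℤ) n = ∅ := by
      ext x
      rw [mem_fixFrom]
      simp only [Finset.notMem_empty, iff_false]
      omega
    rw [this]
    simp [cyc_last hn, prodAlong_one]
  | succ d ih =>
    intro j hj hd
    have ih := ih (j + 1) (by omega) (by omega)
    obtain ⟨i, rfl⟩ : ∃ i : Fin k, (i : ℕ) = j := ⟨⟨j, by omega⟩, rfl⟩
    have hi0 : (i : ℕ) ≠ 0 := by omega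
    have hcyc : 1 ≤ (i : ℕ) + 1 ∧ (i : ℕ) + 1 ≤ n + 1 ∧ n + 1 ≤ k := by omega
    set u := cyc k n (i + 1) * w * (cyc k n (i + 1))⁻¹ with hu
    have hui : u⁻¹ = u := by
      rw [hu, mul_inv_rev, mul_inv_rev, inv_inv, inv_eq_self_of_act hw1, mul_assoc]
    have hconj : cyc k n i * w * (cyc k n i)⁻¹ = simple i * u * simple i := by
      rw [← simple_mul_cyc i (by omega), hu, mul_inv_rev, simple_inv]
      simp only [mul_assoc]
    have hu1 : act u ((i : ℤ) + 1) = (i : ℤ) + 1 := by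
      rw [hu, act_mul, act_mul, act_cyc_inv hcyc, if_pos (by push_cast; rfl), hw3 _ (by omega),
        act_cyc hcyc, if_pos rfl]
      push_cast; rfl
    have hci : act (cyc k n (i + 1))⁻¹ (i : ℤ) = i := by
      rw [act_cyc_inv hcyc]; split_ifs <;> omega
    have hci' : act (cyc k n (i + 1)) (i : ℤ) = i := by
      rw [act_cyc hcyc]; split_ifs <;> omega
    have hu0 : act u i = act (cyc k n (i + 1)) (act w i) := by
      rw [hu, act_mul, act_mul, hci]
    have hum : ∀ m ∈ fixFrom w ((i : ℤ) + 1) n, act u (m + 1) = m + 1 := by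
      intro m hm
      rw [mem_fixFrom] at hm
      have e : act (cyc k n (i + 1))⁻¹ (m + 1) = m := by
        rw [act_cyc_inv hcyc]; split_ifs <;> omega
      have e' := act_act_inv (cyc k n (i + 1)) (m + 1)
      rw [e] at e'
      rw [hu, act_mul, act_mul, e, hm.2, e']
    have hneg : act w i ≠ i → act u i < 0 := by
      intro h
      rw [hu0]
      exact act_cyc_neg hcyc ((hw2 i (by omega)).resolve_left h)
    have hcases : act u i = i ∨ act u i < 0 := by
      by_cases h : act w i = i
      · left; rw [hu0, h, hci']
      · exact Or.inr (hneg h)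
    -- Terms split off earlier do not split again: they take `i + 1` to `m + 1`, which exceeds the
    -- value at `i` before and after applying `s_i`.
    have hterm : ∀ m ∈ fixFrom w ((i : ℤ) + 1) n,
        g i * prodAlong g (u * srefl k ((i : ℤ) + 1) (m + 1)) * g i =
        prodAlong g (simple i * u * simple i * srefl k i (m + 1)) := by
      intro m hm
      have hm1 := hum m hm
      rw [mem_fixFrom] at hm
      have hval : (((i : ℤ) + 1) ≠ 0 ∧ -(k : ℤ) ≤ (i : ℤ) + 1 ∧ (i : ℤ) + 1 ≤ k) ∧
        (m + 1 ≠ 0 ∧ -(k : ℤ) ≤ m + 1 ∧ m + 1 ≤ k) := by omega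
      have hx0 : act (u * srefl k ((i : ℤ) + 1) (m + 1)) i = act u i := by
        rw [act_mul, act_srefl hval]
        split_ifs <;> omega
      have hx1 : act (u * srefl k ((i : ℤ) + 1) (m + 1)) ((i : ℤ) + 1) = m + 1 := by
        rw [act_mul, act_srefl hval, if_pos rfl, hm1]
      have hsm : act (simple i) (m + 1) = m + 1 :=
        act_simple_of_ne i (by omega) (by omega) (by omega)
      rw [conj_prodAlong_of_asc hg]
      · congr 1
        have := conj_srefl (simple i) hval
        rw [act_simple_right i hi0, hsm, simple_inv] at this
        rw [← this]
        simp only [mul_assoc]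
        rw [← mul_assoc (simple i) (simple i), simple_mul_self, one_mul]
      · rw [mul_inv_rev, srefl_inv, hui, mul_srefl_comm u hval hu1 hm1]
      · rw [hx0, hx1]; omega
      · rw [hx0, hx1, hsm]
        rcases hcases with h | h
        · rw [h, act_simple_left i hi0]; omega
        · have := act_simple_neg i hi0 h; omega
    rw [prodAlong_cyc hg i (by omega), prodAlong_cyc_inv hg i (by omega)]
    have e : g i * prodAlong g (cyc k n (i + 1)) * prodAlong g w *
        (prodAlong g (cyc k n (i + 1))⁻¹ * g i) =
        g i * (prodAlong g (cyc k n (i + 1)) * prodAlong g w *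
          prodAlong g (cyc k n (i + 1))⁻¹) * g i := by simp only [mul_assoc]
    rw [e, ih, hconj, mul_add, add_mul, Finset.mul_sum, Finset.sum_mul]
    push_cast
    have hsum : ∑ m ∈ fixFrom w ((i : ℤ) + 1) n,
        g i * ((1 - q) * q ^ (fixFrom w (m + 1) n).card) •
          prodAlong g (u * srefl k ((i : ℤ) + 1) (m + 1)) * g i =
        ∑ m ∈ fixFrom w ((i : ℤ) + 1) n, ((1 - q) * q ^ (fixFrom w (m + 1) n).card) •
          prodAlong g (simple i * u * simple i * srefl k i (m + 1)) := by
      refine Finset.sum_congr rfl fun m hm => ?_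
      rw [mul_smul_comm, smul_mul_assoc, hterm m hm]
    rw [hsum, mul_smul_comm, smul_mul_assoc]
    -- If `w` fixes `i`, the main term splits and supplies the summand `m = i`; otherwise `u(i) < 0`
    -- and it is merely conjugated.
    by_cases h : act w i = i
    · have hu2 : act u i = i := by rw [hu0, h, hci']
      have hsus : simple i * u * simple i = u := by
        have := mul_srefl_comm u (x := i) (y := (i : ℤ) + 1) (by omega) hu2 hu1
        rw [← simple_eq_srefl i hi0] at this
        rw [← this, mul_assoc, simple_mul_self, mul_one]
      rw [fixFrom_of_fix (by omega) h, Finset.sum_insert (notMem_fixFrom_succ w i n),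
        Finset.card_insert_of_notMem (notMem_fixFrom_succ w i n),
        conj_prodAlong_of_fix hg u i hu2 hu1, if_neg hi0, hsus, ← simple_eq_srefl i hi0, smul_add,
        smul_smul, smul_smul, pow_succ, mul_comm (1 - q), add_assoc]
    · rw [fixFrom_of_not_fix h, conj_prodAlong_of_asc hg u i hui]
      · have := hneg h
        rw [hu1]; omega
      · rw [hu1, act_simple_right i hi0]
        have := act_simple_neg i hi0 (hneg h)
        omega

/-- Conjugation by the remaining reflection `t`. -/
theorem conj_cyc_prodAlong_zero (hg : IsHeckeFamily p q g) {n : ℕ} (hn : n + 1 ≤ k) {w : B k}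
    (hw : IsGoodAt n w) (t : Fin k) (ht : (t : ℕ) = 0) :
    g t * (prodAlong g (cyc k n 1) * prodAlong g w * prodAlong g (cyc k n 1)⁻¹) * g t =
      (p * q ^ (fixFrom w 1 n).card) • prodAlong g (cyc k n 1 * w * (cyc k n 1)⁻¹) +
      ((1 - p) * q ^ (fixFrom w 1 n).card) •
        prodAlong g (cyc k n 1 * w * (cyc k n 1)⁻¹ * srefl k 1 (-1)) +
      ∑ m ∈ fixFrom w 1 n, ((1 - q) * q ^ (fixFrom w (m + 1) n).card) •
        prodAlong g (cyc k n 1 * w * (cyc k n 1)⁻¹ * srefl k 1 (-(m + 1))) := by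
  rw [conj_cyc_prodAlong hg hn hw n 1 le_rfl (by omega)]
  obtain ⟨hw1, hw2, hw3⟩ := hw
  have hcyc : 1 ≤ 1 ∧ 1 ≤ n + 1 ∧ n + 1 ≤ k := by omega
  set u := cyc k n 1 * w * (cyc k n 1)⁻¹ with hu
  have hui : u⁻¹ = u := by
    rw [hu, mul_inv_rev, mul_inv_rev, inv_inv, inv_eq_self_of_act hw1, mul_assoc]
  have htz : (t : ℤ) = 0 := by omega
  have hu1 : act u 1 = 1 := by
    rw [hu, act_mul, act_mul, act_cyc_inv hcyc, if_pos (by simp), hw3 _ (by omega),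
      act_cyc hcyc, if_pos rfl]
    rfl
  have hterm : ∀ m ∈ fixFrom w 1 n, g t * prodAlong g (u * srefl k 1 (m + 1)) * g t =
      prodAlong g (u * srefl k 1 (-(m + 1))) := by
    intro m hm
    rw [mem_fixFrom] at hm
    have hm1 : act u (m + 1) = m + 1 := by
      have e : act (cyc k n 1)⁻¹ (m + 1) = m := by
        rw [act_cyc_inv hcyc]; split_ifs <;> omega
      have e' := act_act_inv (cyc k n 1) (m + 1)
      rw [e] at e'
      rw [hu, act_mul, act_mul, e, hm.2, e']
    have hval : ((1 : ℤ) ≠ 0 ∧ -(k : ℤ) ≤ 1 ∧ 1 ≤ (k : ℤ)) ∧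
        (m + 1 ≠ 0 ∧ -(k : ℤ) ≤ m + 1 ∧ m + 1 ≤ k) := by omega
    have hx1 : act (u * srefl k 1 (m + 1)) 1 = m + 1 := by
      rw [act_mul, act_srefl hval, if_pos rfl, hm1]
    have hsm : act (simple t) (m + 1) = m + 1 :=
      act_simple_of_ne t (by omega) (by omega) (by omega)
    have hval' : ((1 : ℤ) ≠ 0 ∧ -(k : ℤ) ≤ 1 ∧ 1 ≤ (k : ℤ)) ∧
        ((-1 : ℤ) ≠ 0 ∧ -(k : ℤ) ≤ -1 ∧ -1 ≤ (k : ℤ)) := by omega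
    rw [conj_prodAlong_of_asc hg]
    · congr 1
      have e1 := conj_srefl (simple t) hval
      rw [act_simple_zero t ht, hsm, simple_inv] at e1
      -- Conjugation by `t` turns the reflection in `1, m + 1` into one in `-1, m + 1`; since `u`
      -- fixes `±1`, it commutes with `t` and is unaffected.
      have e2 : srefl k 1 (-(m + 1)) = srefl k (-1) (m + 1) := by
        apply ext_act
        intro x hx
        rw [act_srefl (by omega), act_srefl (by omega)]
        split_ifs <;> omega
      have e3 := mul_srefl_comm u hval' hu1 (by rw [act_neg, hu1])
      rw [← simple_eq_srefl_zero t ht] at e3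
      clear_value u
      rw [e2, ← e1, ← mul_assoc (simple t) u, ← e3]
      simp only [mul_assoc]
    · rw [mul_inv_rev, srefl_inv, hui, mul_srefl_comm u hval hu1 hm1]
    · rw [htz, zero_add, hx1, act_zero]; omega
    · rw [htz, zero_add, hx1, act_zero, act_zero, hsm]; omega
  have hsum : ∑ m ∈ fixFrom w 1 n,
        g t * ((1 - q) * q ^ (fixFrom w (m + 1) n).card) •
          prodAlong g (u * srefl k 1 (m + 1)) * g t =
        ∑ m ∈ fixFrom w 1 n, ((1 - q) * q ^ (fixFrom w (m + 1) n).card) •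
          prodAlong g (u * srefl k 1 (-(m + 1))) := by
    refine Finset.sum_congr rfl fun m hm => ?_
    rw [mul_smul_comm, smul_mul_assoc, hterm m hm]
  rw [mul_add, add_mul, Finset.mul_sum, Finset.sum_mul]
  push_cast
  rw [hsum, mul_smul_comm, smul_mul_assoc, conj_prodAlong_of_fix hg u t (by rw [htz, act_zero])
    (by rw [htz, zero_add, hu1]), if_pos ht, simple_eq_srefl_zero t ht, smul_add, smul_smul,
    smul_smul, mul_comm p, mul_comm (1 - p)]

end Hecke

/-! ### The coefficient as a product over points and pairs. -/

/-- The contribution of the points of `{1, …, n}` to the coefficient of `T_w`. -/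
def pointWeight {k : ℕ} (p q : ℂ) (n : ℕ) (w : B k) : ℂ :=
  ∏ x ∈ Finset.Icc (1 : ℤ) n, if act w x = x then p else if act w x = -x then 1 - p
    else if x < -act w x then p * (1 - q) else 1

/-- The contribution of the pairs in `{1, …, n}` to the coefficient of `T_w`. -/
def pairWeight {k : ℕ} (q : ℂ) (n : ℕ) (w : B k) : ℂ :=
  ∏ x ∈ Finset.Icc (1 : ℤ) n, ∏ y ∈ Finset.Ioc x (n : ℤ),
    if -act w x < y ∧ -act w y < x then q else 1

theorem prod_Ioc_succ (f : ℤ → ℂ) (x n : ℤ) :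
    ∏ y ∈ Finset.Ioc (x + 1) (n + 1), f y = ∏ y ∈ Finset.Ioc x n, f (y + 1) := by
  refine Finset.prod_nbij' (fun y => y - 1) (fun y => y + 1) ?_ ?_ ?_ ?_ ?_ <;> intro y hy <;>
    simp only [Finset.mem_Ioc] at hy ⊢ <;> first | omega | simp

theorem prod_Icc_succ (f : ℤ → ℂ) (n : ℕ) :
    ∏ y ∈ Finset.Icc (1 : ℤ) ((n + 1 : ℕ) : ℤ), f y =
      f 1 * ∏ y ∈ Finset.Icc (1 : ℤ) n, f (y + 1) := by
  have h : Finset.Icc (1 : ℤ) ((n + 1 : ℕ) : ℤ) = insert 1 (Finset.Ioc (0 + 1) ((n : ℤ) + 1)) := by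
    ext x; simp only [Finset.mem_Icc, Finset.mem_insert, Finset.mem_Ioc]; omega
  have h' : Finset.Ioc (0 : ℤ) (n : ℤ) = Finset.Icc (1 : ℤ) n := by
    ext x; simp only [Finset.mem_Icc, Finset.mem_Ioc]; omega
  rw [h, Finset.prod_insert (by simp), prod_Ioc_succ, h']

/-- By `h1`, shifting old points by one preserves tidiness of old pairs. By `h2`, the tidy pairs
containing the new point `1` correspond to the fixed points of `w` from `e` on, each giving a factor
`q`. -/
theorem pairWeight_succ {k : ℕ} (q : ℂ) (n : ℕ) (w w' : B k) (e : ℤ) (he : 1 ≤ e)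
    (h1 : ∀ x y : ℤ, 1 ≤ x → x ≤ n → 1 ≤ y → y ≤ n →
      (-act w' (x + 1) < y + 1 ↔ -act w x < y))
    (h2 : ∀ y : ℤ, 1 ≤ y → y ≤ n →
      (-act w' 1 < y + 1 ∧ -act w' (y + 1) < 1 ↔ e ≤ y ∧ act w y = y)) :
    pairWeight q (n + 1) w' = q ^ (fixFrom w e n).card * pairWeight q n w := by
  rw [pairWeight, pairWeight, prod_Icc_succ]
  refine congrArg₂ (· * ·) ?_ ?_
  · have e1 := prod_Ioc_succ (fun y => if -act w' 1 < y ∧ -act w' y < 1 then q else 1) 0 n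
    push_cast
    rw [zero_add] at e1
    rw [e1]
    rw [← Finset.prod_const, fixFrom, Finset.prod_filter]
    symm
    have hsub : Finset.Icc e (n : ℤ) ⊆ Finset.Ioc 0 (n : ℤ) := by
      intro x; rw [Finset.mem_Icc, Finset.mem_Ioc]; omega
    have hz : ∀ y ∈ Finset.Icc e (n : ℤ), (if act w y = y then q else 1) =
        if -act w' 1 < y + 1 ∧ -act w' (y + 1) < 1 then q else 1 := by
      intro y hy
      rw [Finset.mem_Icc] at hy
      have := h2 y (by omega) (by omega)
      simp only [this, hy.1, true_and]
    rw [Finset.prod_congr rfl hz]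
    apply Finset.prod_subset hsub
    intro y hy hy'
    rw [Finset.mem_Ioc] at hy
    rw [Finset.mem_Icc] at hy'
    rw [if_neg]
    rw [h2 y (by omega) (by omega)]
    omega
  · refine Finset.prod_congr rfl fun x hx => ?_
    rw [Finset.mem_Icc] at hx
    push_cast
    rw [prod_Ioc_succ]
    refine Finset.prod_congr rfl fun y hy => ?_
    rw [Finset.mem_Ioc] at hy
    simp only [h1 x y (by omega) (by omega) (by omega) (by omega),
      h1 y x (by omega) (by omega) (by omega) (by omega)]

theorem mul_self_eq_one_iff {k : ℕ} {w : B k} : w * w = 1 ↔ ∀ x, act w (act w x) = x := by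
  constructor
  · intro h x; rw [← act_mul, h, act_one]
  · intro h; apply ext_act; intro x _; rw [act_mul, act_one, h]

/-- A value of `w` above `n` would be a fixed point, hence equal to its own argument. -/
theorem IsGoodAt.le {k n : ℕ} {w : B k} (h : IsGoodAt n w) {x : ℤ} (hx : x ≤ n) :
    -(n : ℤ) ≤ act w (-x) := by
  rw [act_neg]
  by_contra! hc
  have := h.2.2 (act w x) (by omega)
  rw [h.1] at this
  omega

/-! ### Adding and removing the point `1`. -/

/-- The possible values at `1` of the good involutions obtained from `w` by adding a point. -/
def IsOption {k : ℕ} (n : ℕ) (w : B k) (v : ℤ) : Prop :=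
  v = 1 ∨ v = -1 ∨ (v < -1 ∧ -v - 1 ≤ n ∧ act w (-v - 1) = -v - 1)

/-- The good involution with value `v` at `1` obtained from `w` by shifting all points by one. -/
def extend {k : ℕ} (n : ℕ) (w : B k) (v : ℤ) : B k :=
  cyc k n 1 * w * (cyc k n 1)⁻¹ * srefl k 1 v

/-- The inverse operation of `extend`. -/
def restrict {k : ℕ} (n : ℕ) (w : B k) : B k :=
  (cyc k n 1)⁻¹ * (w * srefl k 1 (act w 1)) * cyc k n 1

theorem srefl_mul_self (k : ℕ) (x y : ℤ) : srefl k x y * srefl k x y = 1 :=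
  mul_eq_one_iff_inv_eq.2 (srefl_inv k x y)

theorem act_conj_cyc_one {k n : ℕ} (hn : n + 1 ≤ k) {w : B k}
    (hw : IsGoodAt n w) : act (cyc k n 1 * w * (cyc k n 1)⁻¹) 1 = 1 := by
  have hcyc : 1 ≤ 1 ∧ 1 ≤ n + 1 ∧ n + 1 ≤ k := by omega
  rw [act_mul, act_mul, act_cyc_inv hcyc, if_pos (by simp), hw.2.2 _ (by omega),
    act_cyc hcyc, if_pos rfl]
  rfl

/-- The cycle moves `1, …, n` up and `-1, …, -n` down by one; a good involution sends a point it
does not fix to a negative one, whence the `- 1`. -/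
theorem act_conj_cyc {k n : ℕ} (hn : n + 1 ≤ k) {w : B k}
    (hw : IsGoodAt n w) {x : ℤ} (h1 : 1 ≤ x) (h2 : x ≤ n) :
    act (cyc k n 1 * w * (cyc k n 1)⁻¹) (x + 1) =
      if act w x = x then x + 1 else act w x - 1 := by
  have hcyc : 1 ≤ 1 ∧ 1 ≤ n + 1 ∧ n + 1 ≤ k := by omega
  have e : act (cyc k n 1)⁻¹ (x + 1) = x := by
    rw [act_cyc_inv hcyc]; split_ifs <;> omega
  have h3 := hw.2.1 x (by omega)
  have h4 := hw.le (x := -x) (by omega)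
  rw [neg_neg] at h4
  rw [act_mul, act_mul, e, act_cyc hcyc]
  split_ifs <;> omega

theorem act_conj_cyc_of_lt {k n : ℕ} (hn : n + 1 ≤ k) {w : B k}
    (hw : IsGoodAt n w) {x : ℤ} (h1 : (n : ℤ) + 1 < x) :
    act (cyc k n 1 * w * (cyc k n 1)⁻¹) x = x := by
  have hcyc : 1 ≤ 1 ∧ 1 ≤ n + 1 ∧ n + 1 ≤ k := by omega
  have e : act (cyc k n 1)⁻¹ x = x := by
    rw [act_cyc_inv hcyc]; split_ifs <;> omega
  have e' := act_act_inv (cyc k n 1) x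
  rw [e] at e'
  rw [act_mul, act_mul, e, hw.2.2 x (by omega), e']

theorem IsOption.valid {k n : ℕ} (hn : n + 1 ≤ k) {w : B k} {v : ℤ} (hv : IsOption n w v) :
    ((1 : ℤ) ≠ 0 ∧ -(k : ℤ) ≤ 1 ∧ 1 ≤ (k : ℤ)) ∧ (v ≠ 0 ∧ -(k : ℤ) ≤ v ∧ v ≤ k) := by
  unfold IsOption at hv
  omega

theorem act_conj_cyc_option {k n : ℕ} (hn : n + 1 ≤ k) {w : B k}
    (hw : IsGoodAt n w) {v : ℤ} (hv : IsOption n w v) :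
    act (cyc k n 1 * w * (cyc k n 1)⁻¹) v = v := by
  have h1 := act_conj_cyc_one hn hw
  rcases hv with rfl | rfl | ⟨h2, h3, h4⟩
  · exact h1
  · rw [act_neg, h1]
  · have := act_conj_cyc hn hw (x := -v - 1) (by omega) (by omega)
    rw [if_pos h4, sub_add_cancel, act_neg] at this
    omega

theorem act_extend_one {k n : ℕ} (hn : n + 1 ≤ k) {w : B k}
    (hw : IsGoodAt n w) {v : ℤ} (hv : IsOption n w v) :
    act (extend n w v) 1 = v := by
  rw [extend, act_mul, act_srefl (IsOption.valid hn hv), if_pos rfl, act_conj_cyc_option hn hw hv]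

theorem act_extend {k n : ℕ} (hn : n + 1 ≤ k) {w : B k}
    (hw : IsGoodAt n w) {v : ℤ} (hv : IsOption n w v) {x : ℤ} (h1 : 1 ≤ x)
    (h2 : x ≤ n) : act (extend n w v) (x + 1) =
      if x + 1 = -v then -1 else if act w x = x then x + 1 else act w x - 1 := by
  have e : act (srefl k 1 v) (x + 1) = if x + 1 = -v then -1 else x + 1 := by
    rw [act_srefl (IsOption.valid hn hv)]
    unfold IsOption at hv
    split_ifs <;> omega
  rw [extend, act_mul, e]
  split_ifs with h3 h4
  · rw [act_neg, act_conj_cyc_one hn hw]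
  · rw [act_conj_cyc hn hw h1 h2, if_pos h4]
  · rw [act_conj_cyc hn hw h1 h2, if_neg h4]

theorem act_extend_of_lt {k n : ℕ} (hn : n + 1 ≤ k) {w : B k}
    (hw : IsGoodAt n w) {v : ℤ} (hv : IsOption n w v) {x : ℤ}
    (h1 : (n : ℤ) + 1 < x) : act (extend n w v) x = x := by
  have e : act (srefl k 1 v) x = x := by
    rw [act_srefl (IsOption.valid hn hv)]
    unfold IsOption at hv
    split_ifs <;> omega
  rw [extend, act_mul, e, act_conj_cyc_of_lt hn hw h1]

theorem isGoodAt_extend {k n : ℕ} (hn : n + 1 ≤ k) {w : B k}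
    (hw : IsGoodAt n w) {v : ℤ} (hv : IsOption n w v) :
    IsGoodAt (n + 1) (extend n w v) := by
  refine ⟨?_, ?_, ?_⟩
  · rw [← mul_self_eq_one_iff]
    have hc := mul_srefl_comm _ (IsOption.valid hn hv) (act_conj_cyc_one hn hw)
      (act_conj_cyc_option hn hw hv)
    have hw2 := mul_self_eq_one_iff.2 hw.1
    unfold extend
    rw [← mul_assoc]
    nth_rw 1 [hc]
    calc _ = srefl k 1 v * (cyc k n 1 * (w * w) * (cyc k n 1)⁻¹) * srefl k 1 v := by group
      _ = 1 := by rw [hw2, mul_one, mul_inv_cancel, mul_one, srefl_mul_self]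
  · intro x hx
    rcases le_or_gt x ((n : ℤ) + 1) with h | h
    · rcases eq_or_ne x 1 with rfl | h1
      · rw [act_extend_one hn hw hv]
        unfold IsOption at hv
        omega
      · have := act_extend hn hw hv (x := x - 1) (by omega) (by omega)
        rw [sub_add_cancel] at this
        have := hw.2.1 (x - 1) (by omega)
        split_ifs at * <;> omega
    · exact Or.inl (act_extend_of_lt hn hw hv h)
  · intro x hx
    exact act_extend_of_lt hn hw hv (by push_cast at hx; exact hx)

theorem restrict_extend {k n : ℕ} (hn : n + 1 ≤ k) {w : B k}
    (hw : IsGoodAt n w) {v : ℤ} (hv : IsOption n w v) :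
    restrict n (extend n w v) = w := by
  rw [restrict, act_extend_one hn hw hv, extend, mul_assoc _ (srefl k 1 v), srefl_mul_self]
  group

theorem extend_restrict {k : ℕ} (n : ℕ) (w : B k) : extend n (restrict n w) (act w 1) = w := by
  rw [extend, restrict]
  calc _ = w * (srefl k 1 (act w 1) * srefl k 1 (act w 1)) := by group
    _ = w := by rw [srefl_mul_self, mul_one]

/-- Multiplying by the reflection in `1` and `w(1)` frees `1` and its partner, if there is one. Both
become fixed points, so after the shift the partner is a fixed point of the smaller involution, as
`IsOption` demands. -/
theorem isGoodAt_restrict {k n : ℕ} (hn : n + 1 ≤ k) {w : B k} (hw : IsGoodAt (n + 1) w) :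
    IsGoodAt n (restrict n w) ∧ IsOption n (restrict n w) (act w 1) := by
  have hcyc : 1 ≤ 1 ∧ 1 ≤ n + 1 ∧ n + 1 ≤ k := by omega
  have h1 := hw.2.1 1 (by omega)
  have h2 := hw.le (x := -1) (by omega)
  rw [neg_neg] at h2
  push_cast at h2
  have hval : ((1 : ℤ) ≠ 0 ∧ -(k : ℤ) ≤ 1 ∧ 1 ≤ (k : ℤ)) ∧
      (act w 1 ≠ 0 ∧ -(k : ℤ) ≤ act w 1 ∧ act w 1 ≤ k) := by omega
  have hr : ∀ x : ℤ, 1 ≤ x → x ≤ n → act (restrict n w) x =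
      if x + 1 = - act w 1 then x else act (cyc k n 1)⁻¹ (act w (x + 1)) := by
    intro x hx1 hx2
    have e : act (cyc k n 1) x = x + 1 := by rw [act_cyc hcyc]; split_ifs <;> omega
    have e2 : act (srefl k 1 (act w 1)) (x + 1) = if x + 1 = -act w 1 then -1 else x + 1 := by
      rw [act_srefl hval]
      split_ifs <;> omega
    rw [restrict, act_mul, act_mul, act_mul, e, e2]
    split_ifs with h
    · have e' := act_inv_act (cyc k n 1) x
      rw [e] at e'
      rw [act_neg, ← h, e']
    · rfl
  have hneg : ∀ x : ℤ, x < 0 → act (cyc k n 1)⁻¹ x < 0 := by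
    intro x hx; rw [act_cyc_inv hcyc]; split_ifs <;> omega
  have hfix : ∀ x : ℤ, 1 ≤ x → x ≤ n → act (cyc k n 1)⁻¹ (x + 1) = x := by
    intro x hx1 hx2; rw [act_cyc_inv hcyc]; split_ifs <;> omega
  have hfix' : ∀ x, (n : ℤ) < x → act (restrict n w) x = x := by
    intro x hx
    rcases eq_or_ne x (n + 1) with rfl | hne
    · have e : act (cyc k n 1) ((n : ℤ) + 1) = 1 := by rw [act_cyc hcyc, if_pos rfl]; rfl
      have e' := act_inv_act (cyc k n 1) ((n : ℤ) + 1)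
      rw [e] at e'
      rw [restrict, act_mul, act_mul, act_mul, e, act_srefl hval, if_pos rfl, hw.1, e']
    · have e : act (cyc k n 1) x = x := by rw [act_cyc hcyc]; split_ifs <;> omega
      have e' := act_inv_act (cyc k n 1) x
      rw [e] at e'
      have e2 : act (srefl k 1 (act w 1)) x = x := by
        rw [act_srefl hval]; split_ifs <;> omega
      rw [restrict, act_mul, act_mul, act_mul, e, e2, hw.2.2 x (by push_cast; omega), e']
  refine ⟨⟨?_, ?_, hfix'⟩, ?_⟩
  · rw [← mul_self_eq_one_iff]
    have hw2 := mul_self_eq_one_iff.2 hw.1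
    -- As an involution, `w` only exchanges the two points of this reflection.
    have hc : w * srefl k 1 (act w 1) = srefl k 1 (act w 1) * w := by
      rw [← mul_inv_eq_iff_eq_mul, conj_srefl w hval, hw.1]
      apply ext_act
      intro x _
      rw [act_srefl hval, act_srefl hval.symm]
      split_ifs <;> omega
    unfold restrict
    nth_rw 1 [hc]
    calc _ = (cyc k n 1)⁻¹ * (srefl k 1 (act w 1) * (w * w) * srefl k 1 (act w 1)) * cyc k n 1 := by
          group
      _ = 1 := by rw [hw2, mul_one, srefl_mul_self, mul_one, inv_mul_cancel]
  · intro x hx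
    rcases le_or_gt x n with h | h
    · rw [hr x (by omega) h]
      split_ifs with h3
      · exact Or.inl rfl
      · rcases hw.2.1 (x + 1) (by omega) with h4 | h4
        · rw [h4, hfix x (by omega) h]; exact Or.inl rfl
        · exact Or.inr (hneg _ h4)
    · exact Or.inl (hfix' x h)
  · rcases h1 with h1 | h1
    · exact Or.inl h1
    · rcases eq_or_ne (act w 1) (-1) with h3 | h3
      · exact Or.inr (Or.inl h3)
      · refine Or.inr (Or.inr ⟨by omega, by omega, ?_⟩)
        rw [hr _ (by omega) (by omega), if_pos (by omega)]

/-- With `v = -(m + 1)`, the point `1` forms tidy pairs exactly with the shifts of fixed points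
above `m`, so counting starts at `e = m + 1`. With `v = ±1`, all old fixed points count. -/
theorem pairWeight_extend {k n : ℕ} (hn : n + 1 ≤ k) {w : B k} (q : ℂ) (hw : IsGoodAt n w) {v : ℤ}
    (hv : IsOption n w v) (e : ℤ) (he : e = if v < -1 then -v else 1) :
    pairWeight q (n + 1) (extend n w v) = q ^ (fixFrom w e n).card * pairWeight q n w := by
  have hv' := hv
  unfold IsOption at hv'
  have h1 := act_extend_one hn hw hv
  apply pairWeight_succ
  · split_ifs at he <;> omega
  · intro x y hx1 hx2 hy1 hy2
    rw [act_extend hn hw hv hx1 hx2]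
    have h2 := hw.2.1 x (by omega)
    split_ifs with h3 h4
    · obtain rfl : v = -(x + 1) := by omega
      rw [neg_neg, add_sub_cancel_right] at hv'
      omega
    · omega
    · omega
  · intro y hy1 hy2
    rw [act_extend hn hw hv hy1 hy2, h1]
    have h2 := hw.2.1 y (by omega)
    split_ifs at he ⊢ <;> omega

/-- The factor by which the weight of the points grows when a point is added. -/
theorem pointWeight_extend {k n : ℕ} (hn : n + 1 ≤ k) {w : B k} (p q : ℂ) (hw : IsGoodAt n w)
    {v : ℤ} (hv : IsOption n w v) :
    pointWeight p q (n + 1) (extend n w v) =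
      (if v = 1 then p else if v = -1 then 1 - p else 1 - q) * pointWeight p q n w := by
  have hv' := hv
  unfold IsOption at hv'
  have h1 := act_extend_one hn hw hv
  rw [pointWeight, pointWeight, prod_Icc_succ, h1]
  have key : ∀ x ∈ Finset.Icc (1 : ℤ) n, x + 1 ≠ -v →
      (if act (extend n w v) (x + 1) = x + 1 then p
        else if act (extend n w v) (x + 1) = -(x + 1) then 1 - p
        else if x + 1 < -act (extend n w v) (x + 1) then p * (1 - q) else 1) =
      (if act w x = x then p else if act w x = -x then 1 - p
        else if x < -act w x then p * (1 - q) else 1) := by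
    intro x hx hxv
    rw [Finset.mem_Icc] at hx
    have h2 := hw.2.1 x (by omega)
    rw [act_extend hn hw hv hx.1 hx.2, if_neg hxv]
    by_cases h3 : act w x = x
    · rw [if_pos h3, if_pos rfl, if_pos h3]
    · rw [if_neg h3, if_neg (by omega), if_neg h3]
      congr 1
      · rw [eq_iff_iff]; omega
      · congr 1
        rw [eq_iff_iff]; omega
  -- When `1` is paired with the old fixed point `m = -v - 1`, the factor `p` of `m` becomes `1`
  -- while the new point contributes `p * (1 - q)`; the net factor is `1 - q`.
  rcases lt_or_ge v (-1) with h | h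
  · have hm : -v - 1 ∈ Finset.Icc (1 : ℤ) n := by rw [Finset.mem_Icc]; omega
    rw [← Finset.mul_prod_erase _ _ hm, ← Finset.mul_prod_erase _ _ hm,
      Finset.prod_congr rfl fun x hx => key x (Finset.mem_of_mem_erase hx) (by
        have := Finset.ne_of_mem_erase hx; omega)]
    rw [act_extend hn hw hv (by omega) (by omega), if_pos (by omega : -v - 1 + 1 = -v),
      if_neg (by omega), if_neg (by omega), if_pos (by omega), if_neg (by omega),
      if_neg (by omega), if_neg (by omega), if_neg (by omega), if_neg (by omega), if_pos (by omega)]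
    ring
  · rw [Finset.prod_congr rfl fun x hx => key x hx (by
      rw [Finset.mem_Icc] at hx; omega)]
    congr 1
    split_ifs <;> first | rfl | omega

/-! ### The induction over the number of points. -/

open Classical in
/-- The set of good involutions that fix all `i > n`. -/
def goodAt (k n : ℕ) : Finset (B k) := Finset.univ.filter (IsGoodAt n)

theorem mem_goodAt {k n : ℕ} {w : B k} : w ∈ goodAt k n ↔ IsGoodAt n w := by
  simp [goodAt]

theorem goodAt_zero (k : ℕ) : goodAt k 0 = {1} := by
  ext w
  rw [mem_goodAt, Finset.mem_singleton]
  constructor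
  · intro h
    apply ext_act
    intro x hx
    rw [act_one, h.2.2 x (by simpa using hx)]
  · rintro rfl
    exact ⟨fun x => by rw [act_one, act_one], fun x _ => Or.inl (act_one x),
      fun x _ => act_one x⟩

/-- The values at `1` that are possible when a point is added to `w`. -/
def options {k : ℕ} (n : ℕ) (w : B k) : Finset ℤ :=
  insert 1 (insert (-1) ((fixFrom w 1 n).image fun m => -(m + 1)))

theorem mem_options {k n : ℕ} {w : B k} {v : ℤ} : v ∈ options n w ↔ IsOption n w v := by
  rw [options, Finset.mem_insert, Finset.mem_insert, Finset.mem_image, IsOption]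
  refine or_congr_right (or_congr_right ⟨?_, ?_⟩)
  · rintro ⟨m, hm, rfl⟩
    rw [mem_fixFrom] at hm
    rw [neg_neg, add_sub_cancel_right]
    exact ⟨by omega, by omega, hm.2⟩
  · rintro ⟨h1, h2, h3⟩
    exact ⟨-v - 1, mem_fixFrom.2 ⟨by omega, h3⟩, by omega⟩

section Hecke

variable {k : ℕ} {A : Type*} [Ring A] [Algebra ℂ A] {p q : ℂ} {g : Fin k → A}

theorem conj_prodAlong_eq_sum_options (hg : IsHeckeFamily p q g) {n : ℕ} (hn : n + 1 ≤ k) {w : B k}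
    (hw : IsGoodAt n w) (t : Fin k) (ht : (t : ℕ) = 0) :
    g t * (prodAlong g (cyc k n 1) * ((pointWeight p q n w * pairWeight q n w) • prodAlong g w) *
      prodAlong g (cyc k n 1)⁻¹) * g t =
    ∑ v ∈ options n w, (pointWeight p q (n + 1) (extend n w v) *
      pairWeight q (n + 1) (extend n w v)) • prodAlong g (extend n w v) := by
  have h1 : (1 : ℤ) ∉ insert (-1) ((fixFrom w 1 n).image fun m => -(m + 1)) := by
    rw [Finset.mem_insert, Finset.mem_image]
    rintro (h | ⟨m, hm, h⟩)
    · omega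
    · rw [mem_fixFrom] at hm; omega
  have h2 : (-1 : ℤ) ∉ (fixFrom w 1 n).image fun m => -(m + 1) := by
    rw [Finset.mem_image]
    rintro ⟨m, hm, h⟩
    rw [mem_fixFrom] at hm; omega
  have o1 : IsOption n w 1 := Or.inl rfl
  have o2 : IsOption n w (-1) := Or.inr (Or.inl rfl)
  have o3 : ∀ m ∈ fixFrom w 1 n, IsOption n w (-(m + 1)) := fun m hm => by
    rw [← mem_options, options]
    exact Finset.mem_insert_of_mem (Finset.mem_insert_of_mem (Finset.mem_image_of_mem _ hm))
  have hs1 : srefl k 1 1 = 1 := by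
    apply ext_act
    intro x _
    rw [act_srefl (by omega), act_one]
    split_ifs <;> omega
  have e1 : extend n w 1 = cyc k n 1 * w * (cyc k n 1)⁻¹ := by rw [extend, hs1, mul_one]
  have c1 : pointWeight p q (n + 1) (extend n w 1) * pairWeight q (n + 1) (extend n w 1) =
      pointWeight p q n w * pairWeight q n w * (p * q ^ (fixFrom w 1 n).card) := by
    rw [pointWeight_extend hn p q hw o1, pairWeight_extend hn q hw o1 1 (by norm_num), if_pos rfl]
    ring
  have c2 : pointWeight p q (n + 1) (extend n w (-1)) * pairWeight q (n + 1) (extend n w (-1)) =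
      pointWeight p q n w * pairWeight q n w * ((1 - p) * q ^ (fixFrom w 1 n).card) := by
    rw [pointWeight_extend hn p q hw o2, pairWeight_extend hn q hw o2 1 (by norm_num),
      if_neg (by norm_num), if_pos rfl]
    ring
  have c3 : ∀ m ∈ fixFrom w 1 n, pointWeight p q (n + 1) (extend n w (-(m + 1))) *
      pairWeight q (n + 1) (extend n w (-(m + 1))) =
      pointWeight p q n w * pairWeight q n w * ((1 - q) * q ^ (fixFrom w (m + 1) n).card) := by
    intro m hm
    have hm' := mem_fixFrom.1 hm
    rw [pointWeight_extend hn p q hw (o3 m hm),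
      pairWeight_extend hn q hw (o3 m hm) (m + 1) (by rw [if_pos (by omega)]; omega),
      if_neg (by omega), if_neg (by omega)]
    ring
  rw [options, Finset.sum_insert h1, Finset.sum_insert h2,
    Finset.sum_image (fun a _ b _ h => by have h' : -(a + 1) = -(b + 1) := h; omega), c1, c2, e1,
    Finset.sum_congr rfl fun m hm => by rw [c3 m hm, mul_smul]]
  rw [mul_smul_comm, smul_mul_assoc, mul_smul_comm, smul_mul_assoc,
    conj_cyc_prodAlong_zero hg hn hw t ht, smul_add, smul_add, smul_smul, smul_smul, add_assoc,
    ← Finset.smul_sum]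
  rfl

/-- After expanding every `w`, the double sum over `w` and its options is reindexed by the bijection
between `extend` and the pair of `restrict` and the value at `1`. -/
theorem prodAlong_longRep_sq (hg : IsHeckeFamily p q g) (n : ℕ) : n ≤ k →
    prodAlong g (longRep k n) ^ 2 =
      ∑ w ∈ goodAt k n, (pointWeight p q n w * pairWeight q n w) • prodAlong g w := by
  induction n with
  | zero =>
    intro _
    rw [longRep_zero, goodAt_zero, Finset.sum_singleton, prodAlong_one]
    simp [pointWeight, pairWeight]
  | succ n ih =>
    intro hn
    obtain ⟨t, ht⟩ : ∃ t : Fin k, (t : ℕ) = 0 := ⟨⟨0, by omega⟩, rfl⟩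
    rw [prodAlong_longRep_succ_sq hg hn t ht, ih (by omega), Finset.mul_sum, Finset.sum_mul,
      Finset.mul_sum, Finset.sum_mul,
      Finset.sum_congr rfl fun w hw =>
        conj_prodAlong_eq_sum_options hg hn (mem_goodAt.1 hw) t ht, Finset.sum_sigma']
    refine Finset.sum_bij' (fun z _ => extend n z.1 z.2)
      (fun w _ => ⟨restrict n w, act w 1⟩) ?_ ?_ ?_ ?_ ?_
    · rintro ⟨w, v⟩ hz
      rw [Finset.mem_sigma, mem_goodAt, mem_options] at hz
      exact mem_goodAt.2 (isGoodAt_extend hn hz.1 hz.2)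
    · intro w hw
      rw [mem_goodAt] at hw
      rw [Finset.mem_sigma, mem_goodAt, mem_options]
      exact isGoodAt_restrict hn hw
    · rintro ⟨w, v⟩ hz
      rw [Finset.mem_sigma, mem_goodAt, mem_options] at hz
      simp only [restrict_extend hn hz.1 hz.2, act_extend_one hn hz.1 hz.2]
    · intro w _
      exact extend_restrict n w
    · intro z _
      rfl

end Hecke

/-! ### From weights to the statistics `a` and `c`. -/

theorem card_filter_signedSet {k : ℕ} (P : ℤ → Prop) [DecidablePred P] :
    (Finset.univ.filter fun i : SignedSet k => 0 < i.1 ∧ P i.1).card =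
      ((Finset.Icc (1 : ℤ) k).filter P).card := by
  refine Finset.card_bij (fun i _ => i.1) ?_ ?_ ?_
  · intro i hi
    have := mem_signed.1 i.2
    rw [Finset.mem_filter] at hi
    rw [Finset.mem_filter, Finset.mem_Icc]
    exact ⟨by omega, hi.2.2⟩
  · intro i _ j _ h
    exact Subtype.ext h
  · intro x hx
    rw [Finset.mem_filter, Finset.mem_Icc] at hx
    exact ⟨⟨x, mem_signed.2 (by omega)⟩, by
      rw [Finset.mem_filter]; exact ⟨Finset.mem_univ _, by simp only; omega, hx.2⟩, rfl⟩

theorem a_eq_card {k : ℕ} (w : B k) :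
    a w = ((Finset.Icc (1 : ℤ) k).filter fun x => act w x = x).card := by
  rw [← card_filter_signedSet, a]
  congr 1
  ext i
  simp only [Finset.mem_filter, act_coe, Subtype.ext_iff]

theorem a_neg_eq_card {k : ℕ} (w : B k) :
    a (neg w) = ((Finset.Icc (1 : ℤ) k).filter fun x => act w x = -x).card := by
  rw [← card_filter_signedSet, a]
  congr 1
  ext i
  simp only [Finset.mem_filter, act_coe, Subtype.ext_iff]
  have : ((neg w).1 i).1 = -(w.1 i).1 := rfl
  rw [this, neg_eq_iff_eq_neg]

theorem pairWeight_eq {k : ℕ} (q : ℂ) (w : B k) : pairWeight q k w = q ^ c w := by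
  rw [pairWeight, Finset.prod_sigma', ← Finset.prod_filter, Finset.prod_const, c]
  congr 1
  symm
  refine Finset.card_bij (fun z _ => ⟨z.1.1, z.2.1⟩) ?_ ?_ ?_
  · rintro ⟨x, y⟩ hz
    have := mem_signed.1 x.2
    have := mem_signed.1 y.2
    simp only [Finset.mem_filter, Finset.mem_univ, true_and] at hz
    simp only [Finset.mem_filter, Finset.mem_sigma, Finset.mem_Icc, Finset.mem_Ioc, act_coe]
    omega
  · rintro ⟨x, y⟩ _ ⟨x', y'⟩ _ h
    simp only [Sigma.mk.injEq, heq_eq_eq] at h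
    exact Prod.ext (Subtype.ext h.1) (Subtype.ext h.2)
  · rintro ⟨x, y⟩ hz
    simp only [Finset.mem_filter, Finset.mem_sigma, Finset.mem_Icc, Finset.mem_Ioc] at hz
    have hx : x ∈ (Finset.Icc (-(k : ℤ)) k).erase 0 := mem_signed.2 (by omega)
    have hy : y ∈ (Finset.Icc (-(k : ℤ)) k).erase 0 := mem_signed.2 (by omega)
    refine ⟨(⟨x, hx⟩, ⟨y, hy⟩), ?_, rfl⟩
    rw [act_coe w ⟨x, hx⟩, act_coe w ⟨y, hy⟩] at hz
    simp only [Finset.mem_filter, Finset.mem_univ, true_and]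
    omega

/-- If `b` is the number of pairs `x < y` exchanged up to sign, then `k = a(w) + a(-w) + 2b`, so the
two halved exponents are `a(w) + b` and `b`; this also makes the truncated subtraction and division
exact. -/
theorem pointWeight_eq {k : ℕ} (p q : ℂ) {w : B k} (hw : IsGoodAt k w) :
    pointWeight p q k w = p ^ ((k + a w - a (neg w)) / 2) * (1 - p) ^ a (neg w) *
      (1 - q) ^ ((k - a w - a (neg w)) / 2) := by
  set b := ((Finset.Icc (1 : ℤ) k).filter fun x => x < -act w x).card with hb
  -- The map `x ↦ -w(x)` matches the smaller with the larger member of each such pair.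
  have hb' : ((Finset.Icc (1 : ℤ) k).filter fun x => 0 < -act w x ∧ -act w x < x).card = b := by
    refine Finset.card_nbij' (fun x => -act w x) (fun x => -act w x) ?_ ?_ ?_ ?_
    · intro x hx
      simp only [Finset.coe_filter, Set.mem_ofPred_eq, Finset.mem_Icc] at hx ⊢
      rw [act_neg, hw.1]
      omega
    · intro x hx
      simp only [Finset.coe_filter, Set.mem_ofPred_eq, Finset.mem_Icc] at hx ⊢
      have := le_act w (x := x) (by omega)
      rw [act_neg, hw.1]
      omega
    · intro x _
      simp only [act_neg, hw.1, neg_neg]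
    · intro x _
      simp only [act_neg, hw.1, neg_neg]
  have hk : k = a w + a (neg w) + b + b := by
    nth_rw 2 [← hb']
    rw [hb, a_eq_card, a_neg_eq_card, Finset.card_filter, Finset.card_filter, Finset.card_filter,
      Finset.card_filter, ← Finset.sum_add_distrib, ← Finset.sum_add_distrib,
      ← Finset.sum_add_distrib]
    have : ∀ x ∈ Finset.Icc (1 : ℤ) k, (if act w x = x then 1 else 0) +
        (if act w x = -x then 1 else 0) + (if x < -act w x then 1 else 0) +
        (if 0 < -act w x ∧ -act w x < x then 1 else 0) = 1 := by
      intro x hx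
      rw [Finset.mem_Icc] at hx
      have := hw.2.1 x (by omega)
      split_ifs <;> omega
    rw [Finset.sum_congr rfl this]
    simp
  have e1 : (k + a w - a (neg w)) / 2 = a w + b := by omega
  have e2 : (k - a w - a (neg w)) / 2 = b := by omega
  rw [e1, e2, pow_add, hb, a_eq_card, a_neg_eq_card, pointWeight]
  have : ∀ x ∈ Finset.Icc (1 : ℤ) k, (if act w x = x then p else if act w x = -x then 1 - p
      else if x < -act w x then p * (1 - q) else 1) =
      (if act w x = x then p else 1) * (if x < -act w x then p else 1) *
      (if act w x = -x then 1 - p else 1) * (if x < -act w x then 1 - q else 1) := by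
    intro x hx
    rw [Finset.mem_Icc] at hx
    split_ifs <;> first | omega | ring
  rw [Finset.prod_congr rfl this, Finset.prod_mul_distrib, Finset.prod_mul_distrib,
    Finset.prod_mul_distrib]
  simp only [← Finset.prod_filter, Finset.prod_const]

theorem good_eq_goodAt (k : ℕ) : good k = goodAt k k := by
  ext w
  simp only [mem_goodAt, good, Finset.mem_filter, IsGood, IsGoodAt, sq, mul_self_eq_one_iff,
    Finset.mem_univ, true_and]
  refine and_congr_right fun _ => ⟨fun h => ⟨fun x hx => ?_, fun x hx => act_of_lt w hx⟩,
    fun h i hi => ?_⟩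
  · rcases le_or_gt x k with hk | hk
    · have hx' : x ∈ (Finset.Icc (-(k : ℤ)) k).erase 0 := mem_signed.2 (by omega)
      rw [act_coe w ⟨x, hx'⟩]
      exact (h ⟨x, hx'⟩ hx).imp_left (congrArg Subtype.val)
    · exact Or.inl (act_of_lt w hk)
  · rw [← act_coe]
    refine (h.1 i.1 hi).imp_left fun e => Subtype.ext ?_
    rw [← act_coe, e]

/-! ### Identification of `w_{0,k}`. -/

/-- The inversions of a representative of maximal length. -/
def negPairs (k : ℕ) : Finset (ℤ × ℤ) :=
  (Finset.Icc (-(k : ℤ)) k ×ˢ Finset.Icc (1 : ℤ) k).filter fun z => -z.2 < z.1 ∧ z.1 ≤ 0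

theorem act_pos_of_mem_symmetricSubgroup {k : ℕ} {u : B k} (hu : u ∈ symmetricSubgroup k) :
    ∀ x : ℤ, 0 < x → 0 < act u x := by
  induction hu using Subgroup.closure_induction with
  | mem u h =>
    obtain ⟨i, hi, rfl⟩ := h
    intro x hx
    rw [act_simple]
    split_ifs <;> omega
  | one => intro x hx; rw [act_one]; exact hx
  | mul u v _ _ hu hv => intro x hx; rw [act_mul]; exact hu _ (hv x hx)
  | inv u _ hu =>
    intro x hx
    by_contra! h
    rcases h.lt_or_eq with h | h
    · have := hu (-act u⁻¹ x) (by omega)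
      rw [act_neg, act_act_inv] at this
      omega
    · exact act_ne_zero u⁻¹ (by omega) h

theorem card_negPairs_le {k : ℕ} {w : B k} (h : ∀ x : ℤ, 0 < x → x ≤ k → act w x < 0) :
    (negPairs k).card ≤ invCount w := by
  apply Finset.card_le_card
  rintro ⟨x, y⟩ hz
  simp only [negPairs, Finset.mem_filter, Finset.mem_product, Finset.mem_Icc] at hz ⊢
  refine ⟨hz.1, hz.2.1, by omega, ?_⟩
  have h1 := h y (by omega) (by omega)
  rcases hz.2.2.lt_or_eq with h2 | rfl
  · have := h (-x) (by omega) (by omega)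
    rw [act_neg] at this
    omega
  · rw [act_zero]; exact h1

theorem act_longRep_of_pos {k : ℕ} {x : ℤ} (h1 : 0 < x) (h2 : x ≤ k) :
    act (longRep k k) x < 0 := by
  rw [act_longRep le_rfl, if_pos (by omega)]
  omega

theorem strictMono_act {k : ℕ} {w : B k}
    (h : ∀ i : Fin k, (i : ℕ) ≠ 0 → act w i < act w ((i : ℤ) + 1)) (d : ℕ) (x : ℤ) (hx : 0 < x)
    (hd : x + d + 1 ≤ k) : act w x < act w (x + d + 1) := by
  have hstep : ∀ y : ℤ, 0 < y → y + 1 ≤ k → act w y < act w (y + 1) := by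
    intro y hy hk
    have := h ⟨y.toNat, by omega⟩ (by simp only; omega)
    simp only [Int.toNat_of_nonneg hy.le] at this
    exact this
  induction d with
  | zero => simpa using hstep x hx (by simpa using hd)
  | succ d ih =>
    push_cast at hd ⊢
    exact (ih (by omega)).trans (by
      have := hstep (x + d + 1) (by omega) (by omega)
      rwa [← add_assoc])

theorem invCount_longRep_le {k : ℕ} : invCount (longRep k k) ≤ (negPairs k).card := by
  apply Finset.card_le_card
  rintro ⟨x, y⟩ hz
  simp only [negPairs, Finset.mem_filter, Finset.mem_product, Finset.mem_Icc] at hz ⊢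
  refine ⟨hz.1, hz.2.1, ?_⟩
  by_contra! hx
  have h := hz.2.2.2
  rw [act_longRep le_rfl, act_longRep le_rfl, if_pos (by omega), if_pos (by omega)] at h
  omega

/-- Elements of `S_k` preserve positivity, so the inverse of every element of the coset makes all of
`1, …, k` negative and has all of `negPairs k` as inversions; `longRep k k` has no others. -/
theorem longRep_mem_distinguishedReps (k : ℕ) : longRep k k ∈ distinguishedReps k := by
  intro u hu
  rw [length_eq_invCount, ← length_inv (u * _), length_eq_invCount, mul_inv_rev,
    longRep_inv le_rfl]
  refine invCount_longRep_le.trans (card_negPairs_le fun x hx hk => ?_)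
  rw [act_mul]
  exact act_longRep_of_pos (act_pos_of_mem_symmetricSubgroup (inv_mem hu) x hx) (act_le _ hk)

/-- Minimality in the coset makes the inverse of `w0 k` increasing on `1, …, k`, which confines its
inversions to `negPairs k`. Maximality forces all of these to occur, and an increasing map with only
negative values there is unique. -/
theorem w0_eq_longRep (k : ℕ) : w0 k = longRep k k := by
  obtain ⟨h1, h2⟩ := (exists_longest_rep k).choose_spec
  change w0 k ∈ distinguishedReps k at h1
  change ∀ x ∈ distinguishedReps k, length x ≤ length (w0 k) at h2
  have hasc : ∀ i : Fin k, (i : ℕ) ≠ 0 → act (w0 k)⁻¹ i < act (w0 k)⁻¹ ((i : ℤ) + 1) := by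
    intro i hi
    have h3 := h1 (simple i) (Subgroup.subset_closure ⟨i, hi, rfl⟩)
    rcases asc_or_desc (w0 k)⁻¹ i with h | h
    · exact h
    · have h4 := length_mul_simple_of_desc _ i h
      rw [← length_inv, mul_inv_rev, simple_inv, inv_inv, length_inv] at h4
      omega
  have hlen : (negPairs k).card ≤ invCount (w0 k)⁻¹ := by
    rw [← length_eq_invCount, length_inv]
    refine le_trans ?_ (h2 _ (longRep_mem_distinguishedReps k))
    rw [length_eq_invCount]
    exact card_negPairs_le fun x => act_longRep_of_pos
  have hsub : ((Finset.Icc (-(k : ℤ)) k ×ˢ Finset.Icc (1 : ℤ) k).filter fun z =>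
      -z.2 < z.1 ∧ z.1 < z.2 ∧ act (w0 k)⁻¹ z.2 < act (w0 k)⁻¹ z.1) ⊆ negPairs k := by
    rintro ⟨x, y⟩ hz
    simp only [negPairs, Finset.mem_filter, Finset.mem_product, Finset.mem_Icc] at hz ⊢
    refine ⟨hz.1, hz.2.1, ?_⟩
    by_contra! hx
    have h := strictMono_act hasc (y - x - 1).toNat x hx (by omega)
    rw [show x + ((y - x - 1).toNat : ℤ) + 1 = y by omega] at h
    omega
  have heq := Finset.eq_of_subset_of_card_le hsub hlen
  have hneg : ∀ x : ℤ, 0 < x → x ≤ k → act (w0 k)⁻¹ x < 0 := by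
    intro x hx hk
    have hmem : ((0 : ℤ), x) ∈ negPairs k := by
      simp only [negPairs, Finset.mem_filter, Finset.mem_product, Finset.mem_Icc]
      omega
    rw [← heq, Finset.mem_filter] at hmem
    have h := hmem.2.2.2
    change act (w0 k)⁻¹ x < act (w0 k)⁻¹ 0 at h
    rwa [act_zero] at h
  -- On negative values `longRep k k` adds `k + 1`, so the product is positive and increasing on `1,
  -- …, k` and has no descent.
  have hone : longRep k k * (w0 k)⁻¹ = 1 := by
    apply eq_one_of_asc
    intro i
    have hlr : ∀ x : ℤ, 0 < x → x ≤ k →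
        act (longRep k k * (w0 k)⁻¹) x = act (w0 k)⁻¹ x + k + 1 := by
      intro x hx hk
      have a1 := hneg x hx hk
      have a2 := le_act (w0 k)⁻¹ (x := x) (by omega)
      rw [act_mul, act_longRep le_rfl, if_neg (by omega), if_pos (by omega)]
    rcases eq_or_ne (i : ℕ) 0 with h0 | h0
    · have a2 := le_act (w0 k)⁻¹ (x := 1) (by omega)
      rw [h0, Nat.cast_zero, zero_add, act_zero, hlr 1 (by omega) (by omega)]
      omega
    · have := hasc i h0
      rw [hlr _ (by omega) (by omega), hlr _ (by omega) (by omega)]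
      omega
  rw [mul_inv_eq_one] at hone
  exact hone.symm

end TypeB

end


/-- For `w ∈ G_k` the numbers `k + a(w) - a(-w)` and `k - a(w) - a(-w)` are nonnegative and even,
so subtraction and division of natural numbers are exact here. -/
theorem theorem3p4 (k : ℕ) (hk : 1 ≤ k) (p q : ℂ) :
    TypeB.T p q (TypeB.w0 k) ^ 2 =
      ∑ w ∈ TypeB.good k,
        (p ^ ((k + TypeB.a w - TypeB.a (TypeB.neg w)) / 2) *
          (1 - p) ^ TypeB.a (TypeB.neg w) *
          q ^ TypeB.c w *
          (1 - q) ^ ((k - TypeB.a w - TypeB.a (TypeB.neg w)) / 2)) • TypeB.T p q w := by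
  rw [TypeB.w0_eq_longRep, TypeB.good_eq_goodAt]
  refine (TypeB.prodAlong_longRep_sq (TypeB.isHeckeFamily_heckeGen k p q) k le_rfl).trans ?_
  refine Finset.sum_congr rfl fun w hw => ?_
  rw [TypeB.pairWeight_eq, TypeB.pointWeight_eq p q (TypeB.mem_goodAt.1 hw)]
  change _ • TypeB.T p q w = _
  congr 1
  ring
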